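/- Let $\mathcal X$, $\mathcal Y$ be finite nonempty alphabets, $W(y\,|\,x)$ transition probabilities from $\mathcal X$ to $\mathcal Y$, and $R,K>0$. A codebook $\mathcal C_n$ consists of $\lfloor e^{nR}\rfloor$ (not necessarily distinct) codewords ${\bf x}_m\in\mathcal X^n$. Given $\mathcal C_n$, a channel instance is generated at random: for each message $m$, a cloud of $\lfloor e^{nK}\rfloor$ (not necessarily distinct) blocks ${\bf y}\in\mathcal Y^n$ is drawn, where all letters of all blocks of all clouds are independent and each letter $y_i$ of a block in the cloud of $m$ has distribution $W(\cdot\,|\,x_{mi})$. A message $m$ is chosen uniformly, and the channel outputs a block chosen uniformly (over the $\lfloor e^{nK}\rfloor$ indices) from the cloud of $m$. The decoder knows the codebook and the channel instance and uses maximum-likelihood decoding, i.e. it chooses, with ties broken uniformly at random, a message whose cloud contains the largest number of replicas of the received block. Let $P_e(\mathcal C_n)$ be its error probability, averaged over messages and channel instances. For a distribution $P$ on $\mathcal X$ and conditional distributions $U(y\,|\,x)$, let $D(U\|W|P)=\sum_{x,y}P(x)U(y|x)\log\frac{U(y|x)}{W(y|x)}$, let $I_{PU}$ be the mutual information of a pair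 $(X,Y)$ with joint distribution $P(x)U(y|x)$, and let $B_{PU}=\sum_{x,y}P(x)U(y|x)\,[-\log W(y|x)]$, with natural logarithms and the usual conventions ($D$ and $B_{PU}$ may be $+\infty$). Write $|t|^+=\max\{0,t\}$, and define $$E_c(R,K)=\min_{P,U}\Big\{D(U\|W|P)+\big|R-I_{PU}-|B_{PU}-K|^+\big|^+\Big\},$$ $$E_e(R,K)=\max_{P}\ \min_{U:\ I_{PU}+|B_{PU}-K|^+\le R} D(U\|W|P),$$ where maxima and minima are understood as suprema and infima, and a minimum over the empty set is $+\infty$. Then: (1) for all $R,K>0$, $$\liminf_{n\to\infty}\ \min_{\mathcal C_n}\ -\tfrac1n\log\big[1-P_e(\mathcal C_n)\big]\ \ge\ E_c(R,K);$$ (2) for every $K>0$, $E_e(R,K)$ is non-increasing in $R$, and for all $R>0$ $$\limsup_{n\to\infty}\ \max_{\mathcal C_n}\ -\tfrac1n\log P_e(\mathcal C_n)\ \le\ E_e(R,K)$$ (with $-\log 0=+\infty$), except possibly when $R$ is the rate at which $E_e(\cdot,K)$ jumps from $+\infty$ to a finite value, i.e. when $E_e(R',K)=+\infty$ for all $R'<R$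 but $E_e(R,K)<+\infty$. -/

import Mathlib

namespace CloudChannel

noncomputable section

/-- The integer `⌊e^{nr}⌋`: the number of messages for `r = R`, the cloud size for `r = K`. -/
def expSize (n : ℕ) (r : ℝ) : ℕ := ⌊Real.exp ((n : ℝ) * r)⌋₊

/-- A block code of length `n` with `M` messages; repeated codewords are allowed. -/
abbrev Codebook (X : Type*) (n M : ℕ) : Type _ := Fin M → Fin n → X

/-- A channel instance: for each of the `M` messages, a cloud of `L` (not necessarily distinct)
output blocks. -/
abbrev Instance (Y : Type*) (n M L : ℕ) : Type _ := Fin M → Fin L → Fin n → Y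

variable {X Y : Type*} {n M L : ℕ}

/-- Probability of generating the instance `ω` for the codebook `C`: all letters of all blocks of
all clouds are independent, each distributed by `W` given the corresponding codeword letter. -/
def instanceProb (W : X → Y → ℝ) (C : Codebook X n M) (ω : Instance Y n M L) : ℝ :=
  ∏ m, ∏ l, ∏ i, W (C m i) (ω m l i)

/-- The number of replicas of the block `y` in the cloud of the message `m`. The likelihood of `m`
given the received block `y` and the instance `ω` is this number divided by `L`. -/
def replicas [DecidableEq Y] (ω : Instance Y n M L) (m : Fin M) (y : Fin n → Y) : ℕ :=
  (Finset.univ.filter fun l => ω m l = y).card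

/-- The messages of maximal likelihood given the received block `y`. -/
def mlSet [DecidableEq Y] (ω : Instance Y n M L) (y : Fin n → Y) : Finset (Fin M) :=
  Finset.univ.filter fun m => ∀ m', replicas ω m' y ≤ replicas ω m y

/-- The probability that the maximum-likelihood decoder, which knows the instance and breaks ties
uniformly at random, outputs the message `m` when it receives `y`. -/
def mlDecoder [DecidableEq Y] (ω : Instance Y n M L) (y : Fin n → Y) (m : Fin M) : ℝ :=
  if m ∈ mlSet ω y then 1 / ((mlSet ω y).card : ℝ) else 0

/-- Error probability of the maximum-likelihood decoder for a given instance: the message is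
uniform, and the channel outputs a uniformly chosen element of the cloud of this message. -/
def instanceErrorProb [DecidableEq Y] (ω : Instance Y n M L) : ℝ :=
  ∑ m, (1 / (M : ℝ)) * ∑ l, (1 / (L : ℝ)) * (1 - mlDecoder ω (ω m l) m)

/-- Error probability of the maximum-likelihood decoder for the codebook `C` and cloud size `L`,
averaged over messages and over channel instances. -/
def errorProb [Fintype Y] [DecidableEq Y] (W : X → Y → ℝ) (C : Codebook X n M) (L : ℕ) : ℝ :=
  ∑ ω : Instance Y n M L, instanceProb W C ω * instanceErrorProb ω

/-- The exponent `-(1/n) log p`, equal to `+∞` for `p = 0` (and `n ≥ 1`). -/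
def exponent (n : ℕ) (p : ℝ) : EReal :=
  -(((1 / (n : ℝ) : ℝ) : EReal) * ENNReal.log (ENNReal.ofReal p))

/-- The positive part `|t|⁺ = max {0, t}`. -/
def posPart (t : EReal) : EReal := max 0 t

variable [Fintype X] [Fintype Y]

/-- The conditional divergence `D(U ‖ W | P) = ∑ P(x) U(y|x) log (U(y|x) / W(y|x))`, with
`0 log (0 / w) = 0` and value `+∞` if `P(x) U(y|x) > 0 = W(y|x)` for some `x`, `y`. -/
def condDiv (P : X → ℝ) (U W : X → Y → ℝ) : EReal :=
  ∑ x, ∑ y, ((P x * U x y : ℝ) : EReal) *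
    ENNReal.log (ENNReal.ofReal (U x y) / ENNReal.ofReal (W x y))

/-- The mutual information `I_{PU}` of a pair with joint distribution `P(x) U(y|x)`. A term with
`P(x) U(y|x) = 0` vanishes, and in all the others the argument of the logarithm is positive. -/
def mutualInfo (P : X → ℝ) (U : X → Y → ℝ) : ℝ :=
  ∑ x, ∑ y, P x * U x y * Real.log (U x y / ∑ x', P x' * U x' y)

/-- `B_{PU} = E_{PU}[-log W(Y|X)]`, with `0 · (+∞) = 0`; it may be `+∞`. -/
def expNegLog (W : X → Y → ℝ) (P : X → ℝ) (U : X → Y → ℝ) : EReal :=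
  ∑ x, ∑ y, ((P x * U x y : ℝ) : EReal) * (-ENNReal.log (ENNReal.ofReal (W x y)))

/-- The conditional distributions on `Y` given a letter of `X`. -/
def channels (X Y : Type*) [Fintype Y] : Set (X → Y → ℝ) := {U | ∀ x, U x ∈ stdSimplex ℝ Y}

/-- `E_c(R, K) = min_{PU} { D(U‖W|P) + | R - I_{PU} - |B_{PU} - K|⁺ |⁺ }`. -/
def correctExp (W : X → Y → ℝ) (R K : ℝ) : EReal :=
  ⨅ P ∈ stdSimplex ℝ X, ⨅ U ∈ channels X Y,
    condDiv P U W +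
      posPart (((R - mutualInfo P U : ℝ) : EReal) - posPart (expNegLog W P U - (K : EReal)))

/-- `E_e(R, K) = max_P min_{U : I_{PU} + |B_{PU} - K|⁺ ≤ R} D(U‖W|P)`; a minimum over the empty
set is `+∞`. -/
def errorExp (W : X → Y → ℝ) (R K : ℝ) : EReal :=
  ⨆ P ∈ stdSimplex ℝ X, ⨅ U ∈ {U ∈ channels X Y |
      (mutualInfo P U : EReal) + posPart (expNegLog W P U - (K : EReal)) ≤ (R : EReal)},
    condDiv P U W

/-- `R` is the rate at which `E_e(·, K)` jumps from `+∞` to a finite value. -/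
def IsJumpRate (W : X → Y → ℝ) (R K : ℝ) : Prop :=
  (∀ R' < R, errorExp W R' K = ⊤) ∧ errorExp W R K ≠ ⊤

end

end CloudChannel

namespace CloudChannel

open Finset Filter

/-! Write `N_m(y)` for the number of replicas of `y` in the cloud of `m`; it is binomial with mean
`L W(y|x_m)`. Grouping cloud indices by block, the probability of correct decoding is `(1/(ML)) ∑_y
E[max_m N_m(y)]`, and that of error is the same with `∑_m N_m(y) - max_m N_m(y)`
(`one_sub_errorProb_eq`, `errorProb_eq`). Everything rests on two bounds for the mean of a maximum
over a set of messages: the sum of the means, and `log M` plus twice the largest mean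
(`instanceMean_sup_le_log`).

Let `B = crossEntropy P U W`, `H₁ = H(Y|X) = crossEntropy P U U` and `H₂ = H(Y) = outputEntropy P
U`, so that `D = B - H₁` and `I = H₂ - H₁`.

Correct decoding: split the maximum according to the joint type `(P, U)` of codeword and output, at
a polynomial cost. There are at most `M e^{nH₁}` pairs `(m, y)` and at most `e^{nH₂}` blocks `y` of
a given joint type. The sum bound gives the exponent `D`; the logarithmic bound gives `R - H₂ +
min(B, K) = D + R - I - |B - K|⁺`. The better of the two is the expression minimized in `E_c`
(`sum_instanceMean_sup_le`).

Error: pass to a large subcode of one composition `P` and take `U` feasible for `P` with some slack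
in the rate. By Chebyshev each codeword has about `e^{nH₁}` typical outputs, so the expected replica
numbers on typical pairs add up to about `ML e^{-nD}`. All these outputs lie in a set of about
`e^{nH₂}` blocks, and the rate slack makes the subtracted maxima negligible (`le_errorProb`). Slack
comes from convexity: a channel feasible at `R` is mixed with a little of one feasible at some `R' <
R` (`exists_mix`). This is where the jump rate must be excluded. Neither compactness nor continuity
of the exponent is needed. -/

/-- The sum over all functions of a product of functions of the coordinates factorizes. -/
theorem sum_pi_prod {ι B : Type*} [Fintype ι] [DecidableEq ι] [Fintype B] (g : ι → B → ℝ) :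
    ∑ f : ι → B, ∏ i, g i (f i) = ∏ i, ∑ b, g i b := by
  rw [Finset.prod_univ_sum, Fintype.piFinset_univ]

/-- The probability of the block `y` under the memoryless channel `W` with input `x`. -/
noncomputable def blockProb {X Y : Type*} {n : ℕ} (W : X → Y → ℝ) (x : Fin n → X)
    (y : Fin n → Y) : ℝ :=
  ∏ i, W (x i) (y i)

/-- Expectation over the random channel instance. -/
noncomputable def instanceMean {X Y : Type*} [Fintype Y] {n M L : ℕ} (W : X → Y → ℝ)
    (C : Codebook X n M) (F : Instance Y n M L → ℝ) : ℝ :=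
  ∑ ω, instanceProb W C ω * F ω

/-! ### Decoding probabilities as means of sums and maxima of replica numbers. -/

section Mean

variable {X Y : Type*} {n M L : ℕ} {W : X → Y → ℝ}

theorem blockProb_nonneg (hW : ∀ x y, 0 ≤ W x y) (x : Fin n → X) (y : Fin n → Y) :
    0 ≤ blockProb W x y :=
  prod_nonneg fun _ _ => hW _ _

theorem instanceProb_nonneg (hW : ∀ x y, 0 ≤ W x y) (C : Codebook X n M)
    (ω : Instance Y n M L) : 0 ≤ instanceProb W C ω :=
  prod_nonneg fun _ _ => prod_nonneg fun _ _ => prod_nonneg fun _ _ => hW _ _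

theorem replicas_eq_sum [DecidableEq Y] (ω : Instance Y n M L) (m : Fin M) (y : Fin n → Y) :
    (replicas ω m y : ℝ) = ∑ l, if ω m l = y then (1 : ℝ) else 0 := by
  simp [replicas]

/-- A maximum-likelihood decoder collects the largest of the replica numbers of `y`. -/
theorem sum_replicas_mul_mlDecoder [DecidableEq Y] (ω : Instance Y n M L) (y : Fin n → Y)
    (hM : 0 < M) :
    ∑ m, (replicas ω m y : ℝ) * mlDecoder ω y m =
      ((univ.sup fun m => replicas ω m y : ℕ) : ℝ) := by
  have : Nonempty (Fin M) := ⟨⟨0, hM⟩⟩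
  obtain ⟨m₀, -, hm₀⟩ := exists_mem_eq_sup (univ : Finset (Fin M)) univ_nonempty
    (fun m => replicas ω m y)
  have hmem : ∀ m, m ∈ mlSet ω y ↔ replicas ω m y = univ.sup fun m => replicas ω m y := by
    intro m
    simp only [mlSet, mem_filter, mem_univ, true_and]
    constructor
    · intro h
      refine le_antisymm (le_sup (f := fun m => replicas ω m y) (mem_univ m)) ?_
      exact Finset.sup_le fun m' _ => h m'
    · intro h m'
      rw [h]
      exact le_sup (f := fun m => replicas ω m y) (mem_univ m')
  have hne : (mlSet ω y).Nonempty := ⟨m₀, (hmem m₀).2 hm₀.symm⟩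
  have hc : ((mlSet ω y).card : ℝ) ≠ 0 := by exact_mod_cast hne.card_pos.ne'
  have : ∀ m, (replicas ω m y : ℝ) * mlDecoder ω y m =
      if m ∈ mlSet ω y then
        ((univ.sup fun m => replicas ω m y : ℕ) : ℝ) * (1 / ((mlSet ω y).card : ℝ)) else 0 := by
    intro m
    unfold mlDecoder
    split_ifs with h
    · rw [(hmem m).1 h]
    · simp
  simp only [this, sum_ite_mem, univ_inter, sum_const, nsmul_eq_mul]
  field_simp

variable [Fintype Y]

theorem sum_blockProb (hW : ∀ x, ∑ y, W x y = 1) (x : Fin n → X) :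
    ∑ y, blockProb W x y = 1 := by
  unfold blockProb
  rw [sum_pi_prod (fun i b => W (x i) b)]
  simp [hW]

theorem sum_instance_prod (g : Fin M → Fin L → (Fin n → Y) → ℝ) :
    ∑ ω : Instance Y n M L, ∏ m, ∏ l, g m l (ω m l) = ∏ m, ∏ l, ∑ b, g m l b := by
  classical
  rw [sum_pi_prod (fun m (f : Fin L → Fin n → Y) => ∏ l, g m l (f l))]
  exact prod_congr rfl fun m _ => sum_pi_prod (g m)

theorem instanceMean_prod (C : Codebook X n M) (g : Fin M → Fin L → (Fin n → Y) → ℝ) :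
    instanceMean W C (fun ω => ∏ m, ∏ l, g m l (ω m l)) =
      ∏ m, ∏ l, ∑ b, blockProb W (C m) b * g m l b := by
  rw [← sum_instance_prod]
  refine sum_congr rfl fun ω _ => ?_
  simp only [instanceProb, blockProb, prod_mul_distrib]

theorem instanceMean_one (hW : ∀ x, ∑ y, W x y = 1) (C : Codebook X n M) :
    instanceMean W C (fun _ : Instance Y n M L => 1) = 1 := by
  have := instanceMean_prod (W := W) C (fun (_ : Fin M) (_ : Fin L) _ => (1 : ℝ))
  simpa [sum_blockProb hW] using this

theorem instanceMean_const (hW : ∀ x, ∑ y, W x y = 1) (C : Codebook X n M) (c : ℝ) :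
    instanceMean W C (fun _ : Instance Y n M L => c) = c := by
  have := instanceMean_one (L := L) hW C
  unfold instanceMean at this ⊢
  rw [← sum_mul]
  simp only [mul_one] at this
  rw [this, one_mul]

theorem instanceMean_add (C : Codebook X n M) (F G : Instance Y n M L → ℝ) :
    instanceMean W C (fun ω => F ω + G ω) = instanceMean W C F + instanceMean W C G := by
  simp only [instanceMean, mul_add, sum_add_distrib]

theorem instanceMean_sub (C : Codebook X n M) (F G : Instance Y n M L → ℝ) :
    instanceMean W C (fun ω => F ω - G ω) = instanceMean W C F - instanceMean W C G := by
  simp only [instanceMean, mul_sub, sum_sub_distrib]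

theorem instanceMean_mul_left (C : Codebook X n M) (c : ℝ) (F : Instance Y n M L → ℝ) :
    instanceMean W C (fun ω => c * F ω) = c * instanceMean W C F := by
  simp only [instanceMean, mul_sum]
  exact sum_congr rfl fun _ _ => by ring

theorem instanceMean_sum {ι : Type*} (s : Finset ι) (C : Codebook X n M)
    (F : ι → Instance Y n M L → ℝ) :
    instanceMean W C (fun ω => ∑ j ∈ s, F j ω) = ∑ j ∈ s, instanceMean W C (F j) := by
  simp only [instanceMean, mul_sum]
  exact sum_comm

theorem instanceMean_mono (hW : ∀ x y, 0 ≤ W x y) (C : Codebook X n M)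
    {F G : Instance Y n M L → ℝ} (h : ∀ ω, F ω ≤ G ω) :
    instanceMean W C F ≤ instanceMean W C G :=
  sum_le_sum fun ω _ => mul_le_mul_of_nonneg_left (h ω) (instanceProb_nonneg hW C ω)

variable [DecidableEq Y]

theorem instanceMean_replicas (hW : ∀ x, ∑ y, W x y = 1) (C : Codebook X n M) (m : Fin M)
    (y : Fin n → Y) :
    instanceMean W C (fun ω : Instance Y n M L => (replicas ω m y : ℝ)) =
      L * blockProb W (C m) y := by
  simp only [replicas_eq_sum]
  rw [instanceMean_sum]
  have key : ∀ l : Fin L, instanceMean W C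
      (fun ω : Instance Y n M L => if ω m l = y then (1 : ℝ) else 0) = blockProb W (C m) y := by
    intro l
    -- The indicator is a product with a single nontrivial factor; all other blocks integrate to 1.
    have h := instanceMean_prod (W := W) C
      (fun m' l' b => if m' = m then (if l' = l then (if b = y then (1 : ℝ) else 0) else 1) else 1)
    convert h using 1
    · congr 1
      funext ω
      rw [Fintype.prod_eq_single m (fun m' hm' => by simp [hm']),
        Fintype.prod_eq_single l (fun l' hl' => by simp [hl'])]
      simp
    · rw [Fintype.prod_eq_single m (fun m' hm' => by simp [hm', sum_blockProb hW]),
        Fintype.prod_eq_single l (fun l' hl' => by simp [hl', sum_blockProb hW])]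
      simp
  simp [key]

/-- The replica number is binomial, so the mean is `(1 + (e - 1) p) ^ L`; `e - 1 ≤ 2` and `1 + t ≤
exp t` produce the factor 2. -/
theorem instanceMean_exp_replicas_le (hW0 : ∀ x y, 0 ≤ W x y) (hW : ∀ x, ∑ y, W x y = 1)
    (C : Codebook X n M) (m : Fin M) (y : Fin n → Y) :
    instanceMean W C (fun ω : Instance Y n M L => Real.exp (replicas ω m y)) ≤
      Real.exp (2 * (L * blockProb W (C m) y)) := by
  have h := instanceMean_prod (W := W) C
    (fun m' (_ : Fin L) b => if m' = m then (if b = y then Real.exp 1 else 1) else 1)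
  have e1 : instanceMean W C (fun ω : Instance Y n M L => Real.exp (replicas ω m y)) =
      ∏ _l : Fin L, (1 + (Real.exp 1 - 1) * blockProb W (C m) y) := by
    convert h using 1
    · congr 1
      funext ω
      rw [Fintype.prod_eq_single m (fun m' hm' => by simp [hm']), replicas_eq_sum, Real.exp_sum]
      refine prod_congr rfl fun l _ => ?_
      by_cases hl : ω m l = y <;> simp [hl]
    · rw [Fintype.prod_eq_single m (fun m' hm' => by simp [hm', sum_blockProb hW])]
      refine prod_congr rfl fun l _ => ?_
      have : ∀ b, blockProb W (C m) b * (if m = m then (if b = y then Real.exp 1 else 1) else 1) =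
          blockProb W (C m) b +
            if b = y then (Real.exp 1 - 1) * blockProb W (C m) b else 0 := by
        intro b
        by_cases hb : b = y <;> simp [hb]; ring
      refine Eq.trans ?_ (sum_congr rfl fun b _ => (this b).symm)
      rw [sum_add_distrib, sum_blockProb hW]
      simp
  rw [e1, prod_const, card_univ, Fintype.card_fin]
  have hp := blockProb_nonneg hW0 (C m) y
  have he : Real.exp 1 - 1 ≤ 2 := by linarith [Real.exp_one_lt_d9]
  have he0 : 0 ≤ Real.exp 1 - 1 := by linarith [Real.add_one_le_exp (1 : ℝ)]
  calc (1 + (Real.exp 1 - 1) * blockProb W (C m) y) ^ L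
      ≤ (Real.exp (2 * blockProb W (C m) y)) ^ L := by
        gcongr
        nlinarith [Real.add_one_le_exp (2 * blockProb W (C m) y)]
    _ = Real.exp (2 * (L * blockProb W (C m) y)) := by
        rw [← Real.exp_nat_mul]; ring_nf

/-- The mean of the largest of the replica numbers of `y` in a set of clouds exceeds the largest
mean by at most a logarithmic term. -/
theorem instanceMean_sup_le_log (hW0 : ∀ x y, 0 ≤ W x y) (hW : ∀ x, ∑ y, W x y = 1)
    (C : Codebook X n M) (S : Finset (Fin M)) (hS : S.Nonempty) (y : Fin n → Y) (μ : ℝ)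
    (hμ : ∀ m ∈ S, L * blockProb W (C m) y ≤ μ) :
    instanceMean W C (fun ω : Instance Y n M L => ((S.sup fun m => replicas ω m y : ℕ) : ℝ)) ≤
      Real.log M + 2 * μ := by
  have hcard : (0 : ℝ) < S.card := by exact_mod_cast hS.card_pos
  have hcM : (S.card : ℝ) ≤ M := by
    have := S.card_le_univ
    rw [Fintype.card_fin] at this
    exact_mod_cast this
  set a : ℝ := S.card * Real.exp (2 * μ) with ha
  have ha0 : 0 < a := by positivity
  -- The exponential lies above its tangent at `log a`, and the largest exponential is at most the
  -- sum of all. With this `a` the mean of the last term is at most 1, which cancels the `-1`.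
  have hpt : ∀ ω : Instance Y n M L, ((S.sup fun m => replicas ω m y : ℕ) : ℝ) ≤
      (Real.log a - 1) + a⁻¹ * ∑ m ∈ S, Real.exp (replicas ω m y) := by
    intro ω
    obtain ⟨m, hm, hme⟩ := exists_mem_eq_sup S hS (fun m => replicas ω m y)
    rw [hme]
    have h1 := Real.add_one_le_exp ((replicas ω m y : ℝ) - Real.log a)
    rw [Real.exp_sub, Real.exp_log ha0] at h1
    have h2 : Real.exp (replicas ω m y) ≤ ∑ m ∈ S, Real.exp (replicas ω m y) :=
      single_le_sum (f := fun m => Real.exp (replicas ω m y : ℝ))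
        (fun _ _ => (Real.exp_pos _).le) hm
    have h3 := mul_le_mul_of_nonneg_left h2 (inv_pos.2 ha0).le
    rw [div_eq_inv_mul] at h1
    linarith
  refine (instanceMean_mono hW0 C hpt).trans ?_
  rw [instanceMean_add, instanceMean_const hW, instanceMean_mul_left, instanceMean_sum]
  have h4 : ∑ m ∈ S, instanceMean W C (fun ω : Instance Y n M L => Real.exp (replicas ω m y)) ≤
      a := by
    rw [ha, ← nsmul_eq_mul]
    refine sum_le_card_nsmul _ _ _ fun m hm => ?_
    refine (instanceMean_exp_replicas_le hW0 hW C m y).trans (Real.exp_le_exp.2 ?_)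
    linarith [hμ m hm]
  have h5 := mul_le_mul_of_nonneg_left h4 (inv_pos.2 ha0).le
  rw [inv_mul_cancel₀ ha0.ne'] at h5
  have h6 : Real.log a = Real.log S.card + 2 * μ := by
    rw [ha, Real.log_mul hcard.ne' (Real.exp_pos _).ne', Real.log_exp]
  have h7 := Real.log_le_log hcard hcM
  linarith

/-- Complements the logarithmic bound: it pays no `log M`, hence wins when all expected replica
numbers are small. -/
theorem instanceMean_sup_le_sum (hW0 : ∀ x y, 0 ≤ W x y) (hW : ∀ x, ∑ y, W x y = 1)
    (C : Codebook X n M) (S : Finset (Fin M)) (y : Fin n → Y) :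
    instanceMean W C (fun ω : Instance Y n M L => ((S.sup fun m => replicas ω m y : ℕ) : ℝ)) ≤
      ∑ m ∈ S, L * blockProb W (C m) y := by
  simp only [← instanceMean_replicas (L := L) hW C]
  rw [← instanceMean_sum]
  refine instanceMean_mono hW0 C fun ω => ?_
  rw [← Nat.cast_sum]
  refine Nat.cast_le.2 (Finset.sup_le fun m hm => ?_)
  exact single_le_sum (f := fun m => replicas ω m y) (fun _ _ => Nat.zero_le _) hm

/-- A sum over cloud indices is a sum over blocks weighted by replica numbers, and maximum
likelihood collects exactly the largest of these weights. -/
theorem instanceErrorProb_eq (ω : Instance Y n M L) (hM : 0 < M) :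
    instanceErrorProb ω = (1 / ((M : ℝ) * L)) * ∑ y,
      (∑ m, (replicas ω m y : ℝ) - ((univ.sup fun m => replicas ω m y : ℕ) : ℝ)) := by
  have h1 : ∀ m, ∑ l, (1 / (L : ℝ)) * (1 - mlDecoder ω (ω m l) m) =
      (1 / (L : ℝ)) * ∑ y, (replicas ω m y : ℝ) * (1 - mlDecoder ω y m) := by
    intro m
    rw [← mul_sum]
    congr 1
    simp only [replicas_eq_sum, sum_mul]
    rw [sum_comm]
    refine sum_congr rfl fun l _ => ?_
    simp
  unfold instanceErrorProb
  simp only [h1, ← mul_sum, ← mul_assoc]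
  rw [one_div_mul_one_div, sum_comm]
  congr 1
  refine sum_congr rfl fun y _ => ?_
  rw [← sum_replicas_mul_mlDecoder ω y hM, ← sum_sub_distrib]
  exact sum_congr rfl fun m _ => by ring

theorem errorProb_eq (C : Codebook X n M) (hM : 0 < M) :
    errorProb W C L = (1 / ((M : ℝ) * L)) * ∑ y, instanceMean W C (fun ω : Instance Y n M L =>
      ∑ m, (replicas ω m y : ℝ) - ((univ.sup fun m => replicas ω m y : ℕ) : ℝ)) := by
  have : errorProb W C L = instanceMean W C (fun ω : Instance Y n M L => instanceErrorProb ω) := rfl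
  rw [this, ← instanceMean_sum, ← instanceMean_mul_left]
  congr 1
  funext ω
  exact instanceErrorProb_eq ω hM

theorem one_sub_errorProb_eq (hW : ∀ x, ∑ y, W x y = 1) (C : Codebook X n M) (hM : 0 < M)
    (hL : 0 < L) :
    1 - errorProb W C L = (1 / ((M : ℝ) * L)) * ∑ y, instanceMean W C
      (fun ω : Instance Y n M L => ((univ.sup fun m => replicas ω m y : ℕ) : ℝ)) := by
  rw [errorProb_eq C hM]
  simp only [instanceMean_sub, sum_sub_distrib]
  have : ∑ y, instanceMean W C (fun ω : Instance Y n M L => ∑ m, (replicas ω m y : ℝ)) =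
      M * L := by
    simp only [instanceMean_sum, instanceMean_replicas hW]
    rw [sum_comm]
    simp [← mul_sum, sum_blockProb hW]
  rw [this, mul_sub, one_div_mul_cancel (by positivity)]
  ring

/-- Enlarging the set raises the maximum by no more than the sum of the added terms. Hence errors
may be bounded below using any subset of the messages. -/
theorem sum_sub_sup_mono (f : Fin M → ℕ) (S : Finset (Fin M)) :
    ∑ m ∈ S, (f m : ℝ) - (S.sup f : ℕ) ≤ ∑ m, (f m : ℝ) - (univ.sup f : ℕ) := by
  have h1 : univ.sup f ≤ S.sup f + ∑ m ∈ Sᶜ, f m := by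
    refine Finset.sup_le fun m _ => ?_
    by_cases hm : m ∈ S
    · exact (le_sup hm).trans (Nat.le_add_right _ _)
    · exact (single_le_sum (fun _ _ => Nat.zero_le _) (mem_compl.2 hm)).trans (Nat.le_add_left _ _)
  have h2 : ((univ.sup f : ℕ) : ℝ) ≤ (S.sup f : ℕ) + ∑ m ∈ Sᶜ, (f m : ℝ) := by exact_mod_cast h1
  have h3 := sum_add_sum_compl S (fun m => (f m : ℝ))
  linarith

end Mean

/-! ### Entropies, divergence, and convexity in the channel. -/

section Information

variable {X Y : Type*} [Fintype X]

/-- The output distribution of the channel `U` with input distribution `P`. -/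
noncomputable def outputDist (P : X → ℝ) (U : X → Y → ℝ) (y : Y) : ℝ :=
  ∑ x, P x * U x y

theorem outputDist_pos {P : X → ℝ} {U : X → Y → ℝ} (hP : ∀ x, 0 ≤ P x) (hU : ∀ x y, 0 ≤ U x y)
    {x : X} {y : Y}
    (h : P x * U x y ≠ 0) : 0 < outputDist P U y :=
  (lt_of_le_of_ne (mul_nonneg (hP x) (hU x y)) h.symm).trans_le
    (single_le_sum (f := fun x => P x * U x y) (fun x _ => mul_nonneg (hP x) (hU x y))
      (mem_univ x))

variable [Fintype Y]

/-- The cross entropy `∑ P(x) U(y|x) [-log V(y|x)]` as a real number. -/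
noncomputable def crossEntropy (P : X → ℝ) (U V : X → Y → ℝ) : ℝ :=
  ∑ x, ∑ y, P x * U x y * -Real.log (V x y)

/-- The entropy of the output distribution. -/
noncomputable def outputEntropy (P : X → ℝ) (U : X → Y → ℝ) : ℝ :=
  crossEntropy P U fun _ => outputDist P U

/-- Absolute continuity of the joint distribution `P(x) U(y|x)` with respect to the channel. -/
def IsDominated (W : X → Y → ℝ) (P : X → ℝ) (U : X → Y → ℝ) : Prop :=
  ∀ x y, P x * U x y ≠ 0 → 0 < W x y

variable {W U : X → Y → ℝ} {P : X → ℝ}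

theorem coe_sum_eReal {ι : Type*} (s : Finset ι) (f : ι → ℝ) :
    ((∑ i ∈ s, f i : ℝ) : EReal) = ∑ i ∈ s, (f i : EReal) := by
  classical
  induction s using Finset.induction_on with
  | empty => simp
  | insert a s ha ih => rw [sum_insert ha, sum_insert ha, EReal.coe_add, ih]

theorem sum_ne_bot {ι : Type*} (s : Finset ι) (f : ι → EReal) (h : ∀ i ∈ s, f i ≠ ⊥) :
    ∑ i ∈ s, f i ≠ ⊥ := by
  classical
  induction s using Finset.induction_on with
  | empty => simp
  | insert a s ha ih =>
    rw [sum_insert ha]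
    rw [Ne, EReal.add_eq_bot_iff, not_or]
    exact ⟨h a (mem_insert_self _ _), ih fun i hi => h i (mem_insert_of_mem hi)⟩

theorem sum_eq_top {ι : Type*} (s : Finset ι) (f : ι → EReal) (h : ∀ i ∈ s, f i ≠ ⊥) {i : ι}
    (hi : i ∈ s) (hf : f i = ⊤) : ∑ i ∈ s, f i = ⊤ := by
  classical
  rw [← add_sum_erase s f hi, hf]
  exact EReal.top_add_of_ne_bot (sum_ne_bot _ _ fun j hj => h j (mem_of_mem_erase hj))

/-- `Real.log 0 = 0` while the extended logarithm of 0 is `⊥`; under domination the two differ only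
where the weight `P x * U x y` vanishes. -/
theorem expNegLog_eq (h : IsDominated W P U) :
    expNegLog W P U = (crossEntropy P U W : EReal) := by
  unfold expNegLog crossEntropy
  simp only [coe_sum_eReal]
  refine sum_congr rfl fun x _ => sum_congr rfl fun y _ => ?_
  by_cases h0 : P x * U x y = 0
  · simp [h0]
  · rw [ENNReal.log_ofReal_of_pos (h x y h0), ← EReal.coe_neg, ← EReal.coe_mul]

theorem condDiv_eq (hU : ∀ x y, 0 ≤ U x y) (h : IsDominated W P U) :
    condDiv P U W = ((crossEntropy P U W - crossEntropy P U U : ℝ) : EReal) := by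
  unfold condDiv crossEntropy
  simp only [← sum_sub_distrib]
  simp only [coe_sum_eReal]
  refine sum_congr rfl fun x _ => sum_congr rfl fun y _ => ?_
  by_cases h0 : P x * U x y = 0
  · simp [h0]
  · have hW := h x y h0
    have hu : 0 < U x y := lt_of_le_of_ne (hU x y) (right_ne_zero_of_mul h0).symm
    rw [← ENNReal.ofReal_div_of_pos hW, ENNReal.log_ofReal_of_pos (div_pos hu hW),
      Real.log_div hu.ne' hW.ne', ← EReal.coe_mul]
    congr 1
    ring

theorem isDominated_of_condDiv_ne_top (hP : ∀ x, 0 ≤ P x) (hU : ∀ x y, 0 ≤ U x y)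
    (hW : ∀ x y, 0 ≤ W x y) (h : condDiv P U W ≠ ⊤) : IsDominated W P U := by
  intro x y h0
  by_contra hw
  have hw0 : W x y = 0 := le_antisymm (not_lt.1 hw) (hW x y)
  have hpos : ∀ x y, P x * U x y ≠ 0 → 0 < P x * U x y ∧ 0 < U x y := fun x y h0 =>
    ⟨lt_of_le_of_ne (mul_nonneg (hP x) (hU x y)) h0.symm,
      lt_of_le_of_ne (hU x y) (right_ne_zero_of_mul h0).symm⟩
  -- In `EReal` the value `⊥` absorbs `⊤`, so an infinite term makes the sum infinite only once `⊥`
  -- terms are ruled out.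
  have hbot : ∀ x y, ((P x * U x y : ℝ) : EReal) *
      ENNReal.log (ENNReal.ofReal (U x y) / ENNReal.ofReal (W x y)) ≠ ⊥ := by
    intro x y
    by_cases h0 : P x * U x y = 0
    · simp [h0]
    · obtain ⟨h1, h2⟩ := hpos x y h0
      have h3 : ENNReal.log (ENNReal.ofReal (U x y) / ENNReal.ofReal (W x y)) ≠ ⊥ := by
        rw [Ne, ENNReal.log_eq_bot_iff, ENNReal.div_eq_zero_iff]
        simp [h2]
      generalize P x * U x y = c at h1
      rw [Ne, EReal.mul_eq_bot]
      rintro (⟨h, -⟩ | ⟨-, h⟩ | ⟨h, -⟩ | ⟨h, -⟩)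
      · exact EReal.coe_ne_bot _ h
      · exact h3 h
      · exact EReal.coe_ne_top _ h
      · exact h1.not_gt (EReal.coe_lt_coe_iff.1 h)
  refine h (sum_eq_top _ _ (fun x _ => sum_ne_bot _ _ fun y _ => hbot x y) (mem_univ x)
    (sum_eq_top _ _ (fun y _ => hbot x y) (mem_univ y) ?_))
  obtain ⟨h1, h2⟩ := hpos x y h0
  have h3 : ENNReal.log (ENNReal.ofReal (U x y) / ENNReal.ofReal (W x y)) = ⊤ := by
    rw [ENNReal.log_eq_top_iff, hw0, ENNReal.ofReal_zero, ENNReal.div_zero]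
    simp [h2]
  rw [h3]
  exact EReal.coe_mul_top_of_pos h1

theorem mutualInfo_eq (hP : ∀ x, 0 ≤ P x) (hU : ∀ x y, 0 ≤ U x y) :
    mutualInfo P U = outputEntropy P U - crossEntropy P U U := by
  unfold mutualInfo outputEntropy crossEntropy
  simp only [← sum_sub_distrib]
  refine sum_congr rfl fun x _ => sum_congr rfl fun y _ => ?_
  by_cases h0 : P x * U x y = 0
  · simp [h0]
  · have hq := outputDist_pos hP hU h0
    unfold outputDist at hq ⊢
    rw [Real.log_div (right_ne_zero_of_mul h0) hq.ne']
    ring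

theorem posPart_coe (t : ℝ) : posPart (t : EReal) = ((max 0 t : ℝ) : EReal) := by
  unfold posPart
  rw [EReal.coe_strictMono.monotone.map_max, EReal.coe_zero]

theorem correctExp_le {R K : ℝ} (hP : P ∈ stdSimplex ℝ X) (hU : U ∈ channels X Y)
    (h : IsDominated W P U) :
    correctExp W R K ≤ ((crossEntropy P U W - crossEntropy P U U +
      max 0 (R - (outputEntropy P U - crossEntropy P U U) -
        max 0 (crossEntropy P U W - K)) : ℝ) : EReal) := by
  refine (iInf₂_le P hP).trans ((iInf₂_le U hU).trans (le_of_eq ?_))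
  rw [condDiv_eq (fun x => (hU x).1) h, expNegLog_eq h, mutualInfo_eq hP.1 fun x => (hU x).1,
    ← EReal.coe_sub, posPart_coe, ← EReal.coe_sub, posPart_coe, ← EReal.coe_add]

/-- The supremum over `P` makes the one bound `a` serve every input distribution, and the strict
inequality supplies a channel without the infimum being attained. -/
theorem exists_of_errorExp_lt {R K a : ℝ} (hW : ∀ x y, 0 ≤ W x y) (h : errorExp W R K < a)
    (hP : P ∈ stdSimplex ℝ X) :
    ∃ U ∈ channels X Y, IsDominated W P U ∧
      outputEntropy P U - crossEntropy P U U + max 0 (crossEntropy P U W - K) ≤ R ∧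
      crossEntropy P U W - crossEntropy P U U < a := by
  have h1 := (le_iSup₂ (f := fun P (_ : P ∈ stdSimplex ℝ X) =>
    ⨅ U ∈ {U ∈ channels X Y |
      (mutualInfo P U : EReal) + posPart (expNegLog W P U - (K : EReal)) ≤ (R : EReal)},
    condDiv P U W) P hP).trans_lt h
  simp only [iInf_lt_iff] at h1
  obtain ⟨U, ⟨hU, hI⟩, hD⟩ := h1
  have hac := isDominated_of_condDiv_ne_top hP.1 (fun x => (hU x).1) hW (hD.trans_le le_top).ne
  rw [mutualInfo_eq hP.1 fun x => (hU x).1, expNegLog_eq hac, ← EReal.coe_sub, posPart_coe,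
    ← EReal.coe_add, EReal.coe_le_coe_iff] at hI
  rw [condDiv_eq (fun x => (hU x).1) hac, EReal.coe_lt_coe_iff] at hD
  exact ⟨U, hU, hac, hI, hD⟩

/-- This is `log u ≥ 1 - 1/u` at `u = x / (y s)`. The parameter `s` is free; taken as the common
ratio of the totals, it makes two such bounds add up to the log-sum inequality. -/
theorem mul_log_div_ge {x y s : ℝ} (hx : 0 ≤ x) (hy : 0 ≤ y) (hxy : y = 0 → x = 0) (hs : 0 < s) :
    x * Real.log s + x - y * s ≤ x * Real.log (x / y) := by
  rcases hx.eq_or_lt with rfl | hx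
  · simp; positivity
  have hy : 0 < y := lt_of_le_of_ne hy fun h => hx.ne' (hxy h.symm)
  have h1 := Real.one_sub_inv_le_log_of_pos (x := x / (y * s)) (by positivity)
  rw [Real.log_div hx.ne' (by positivity), Real.log_mul hy.ne' hs.ne', inv_div] at h1
  rw [Real.log_div hx.ne' hy.ne']
  have h2 := mul_le_mul_of_nonneg_left h1 hx.le
  have h3 : x * (1 - y * s / x) = x - y * s := by field_simp
  linarith

/-- The log-sum inequality for two terms. -/
theorem log_sum_inequality {a₁ a₂ b₁ b₂ : ℝ} (ha₁ : 0 ≤ a₁) (ha₂ : 0 ≤ a₂) (hb₁ : 0 ≤ b₁)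
    (hb₂ : 0 ≤ b₂) (h₁ : b₁ = 0 → a₁ = 0) (h₂ : b₂ = 0 → a₂ = 0) :
    (a₁ + a₂) * Real.log ((a₁ + a₂) / (b₁ + b₂)) ≤
      a₁ * Real.log (a₁ / b₁) + a₂ * Real.log (a₂ / b₂) := by
  rcases (add_nonneg ha₁ ha₂).eq_or_lt with h | ha
  · have h1 : a₁ = 0 := by linarith
    have h2 : a₂ = 0 := by linarith
    simp [h1, h2]
  have hb : 0 < b₁ + b₂ := by
    refine lt_of_le_of_ne (add_nonneg hb₁ hb₂) fun h => ha.ne' ?_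
    rw [h₁ (by linarith), h₂ (by linarith), add_zero]
  have k1 := mul_log_div_ge ha₁ hb₁ h₁ (div_pos ha hb)
  have k2 := mul_log_div_ge ha₂ hb₂ h₂ (div_pos ha hb)
  have k3 : b₁ * ((a₁ + a₂) / (b₁ + b₂)) + b₂ * ((a₁ + a₂) / (b₁ + b₂)) = a₁ + a₂ := by
    field_simp
  linarith

theorem mul_mul_log_sum {p s t u v c d : ℝ} (hp : 0 ≤ p) (hs : 0 < s) (ht : 0 < t) (hu : 0 ≤ u)
    (hv : 0 ≤ v) (hc : 0 ≤ c) (hd : 0 ≤ d) (h₁ : p * u ≠ 0 → 0 < c) (h₂ : p * v ≠ 0 → 0 < d) :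
    p * (s * u + t * v) * Real.log ((s * u + t * v) / (s * c + t * d)) ≤
      s * (p * u * Real.log (u / c)) + t * (p * v * Real.log (v / d)) := by
  rcases hp.eq_or_lt with rfl | hp
  · simp
  have := log_sum_inequality (mul_nonneg hs.le hu) (mul_nonneg ht.le hv) (mul_nonneg hs.le hc)
    (mul_nonneg ht.le hd)
    (fun h => by
      by_contra h0
      exact (mul_pos hs (h₁ (mul_ne_zero hp.ne' (right_ne_zero_of_mul h0)))).ne' h)
    (fun h => by
      by_contra h0
      exact (mul_pos ht (h₂ (mul_ne_zero hp.ne' (right_ne_zero_of_mul h0)))).ne' h)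
  rw [mul_div_mul_left _ _ hs.ne', mul_div_mul_left _ _ ht.ne'] at this
  nlinarith [mul_le_mul_of_nonneg_left this hp.le]

theorem sum_mul_log_div_eq {V : X → Y → ℝ} (h : ∀ x y, P x * U x y ≠ 0 → 0 < V x y) :
    crossEntropy P U V - crossEntropy P U U =
      ∑ x, ∑ y, P x * U x y * Real.log (U x y / V x y) := by
  unfold crossEntropy
  simp only [← sum_sub_distrib]
  refine sum_congr rfl fun x _ => sum_congr rfl fun y _ => ?_
  by_cases h0 : P x * U x y = 0
  · simp [h0]
  · rw [Real.log_div (right_ne_zero_of_mul h0) (h x y h0).ne']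
    ring

/-- Joint convexity of relative entropy, termwise from the log-sum inequality. With `V₁ = V₂ = W` it
gives convexity of `D` in the channel; with the output distributions as `V₁`, `V₂` it gives
convexity of the mutual information. -/
theorem crossEntropy_mix_le {U₁ U₂ V₁ V₂ : X → Y → ℝ} {s t : ℝ} (hs : 0 < s) (ht : 0 < t)
    (hP : ∀ x, 0 ≤ P x) (hU₁ : ∀ x y, 0 ≤ U₁ x y) (hU₂ : ∀ x y, 0 ≤ U₂ x y)
    (hV₁ : ∀ x y, 0 ≤ V₁ x y) (hV₂ : ∀ x y, 0 ≤ V₂ x y)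
    (h₁ : ∀ x y, P x * U₁ x y ≠ 0 → 0 < V₁ x y) (h₂ : ∀ x y, P x * U₂ x y ≠ 0 → 0 < V₂ x y) :
    crossEntropy P (fun x y => s * U₁ x y + t * U₂ x y) (fun x y => s * V₁ x y + t * V₂ x y) -
        crossEntropy P (fun x y => s * U₁ x y + t * U₂ x y)
          (fun x y => s * U₁ x y + t * U₂ x y) ≤
      s * (crossEntropy P U₁ V₁ - crossEntropy P U₁ U₁) +
        t * (crossEntropy P U₂ V₂ - crossEntropy P U₂ U₂) := by
  rw [sum_mul_log_div_eq, sum_mul_log_div_eq h₁, sum_mul_log_div_eq h₂]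
  · simp only [mul_sum, ← sum_add_distrib]
    exact sum_le_sum fun x _ => sum_le_sum fun y _ => mul_mul_log_sum (hP x) hs ht (hU₁ x y)
      (hU₂ x y) (hV₁ x y) (hV₂ x y) (h₁ x y) (h₂ x y)
  · intro x y h
    by_cases h1 : P x * U₁ x y = 0
    · have h2 : P x * U₂ x y ≠ 0 := fun h2 => h (by linear_combination s * h1 + t * h2)
      have := mul_pos ht (h₂ x y h2)
      have := mul_nonneg hs.le (hV₁ x y)
      linarith
    · have := mul_pos hs (h₁ x y h1)
      have := mul_nonneg ht.le (hV₂ x y)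
      linarith

/-- Mixing a channel that is feasible at the rate `R₁` with one that is feasible at `R₂`. -/
theorem exists_mix {R₁ R₂ K a₁ a₂ s t : ℝ} (hW : ∀ x y, 0 ≤ W x y) (hs : 0 < s) (ht : 0 < t)
    (hst : s + t = 1) (h₁ : errorExp W R₁ K < a₁) (h₂ : errorExp W R₂ K < a₂)
    (hP : P ∈ stdSimplex ℝ X) :
    ∃ U ∈ channels X Y, IsDominated W P U ∧
      outputEntropy P U - crossEntropy P U U + max 0 (crossEntropy P U W - K) ≤
        s * R₁ + t * R₂ ∧
      crossEntropy P U W - crossEntropy P U U < s * a₁ + t * a₂ := by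
  obtain ⟨U₁, hU₁, hd₁, hI₁, hD₁⟩ := exists_of_errorExp_lt hW h₁ hP
  obtain ⟨U₂, hU₂, hd₂, hI₂, hD₂⟩ := exists_of_errorExp_lt hW h₂ hP
  have hU₁0 : ∀ x y, 0 ≤ U₁ x y := fun x => (hU₁ x).1
  have hU₂0 : ∀ x y, 0 ≤ U₂ x y := fun x => (hU₂ x).1
  have hq : ∀ y, outputDist P (fun x y => s * U₁ x y + t * U₂ x y) y =
      s * outputDist P U₁ y + t * outputDist P U₂ y := by
    intro y
    simp only [outputDist, mul_sum, ← sum_add_distrib]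
    exact sum_congr rfl fun x _ => by ring
  have hW' : (fun x y => s * W x y + t * W x y) = W := by
    funext x y
    rw [← add_mul, hst, one_mul]
  have hD := crossEntropy_mix_le hs ht hP.1 hU₁0 hU₂0 hW hW hd₁ hd₂
  rw [hW'] at hD
  have hI := crossEntropy_mix_le hs ht hP.1 hU₁0 hU₂0
    (V₁ := fun _ => outputDist P U₁) (V₂ := fun _ => outputDist P U₂)
    (fun _ y => sum_nonneg fun x _ => mul_nonneg (hP.1 x) (hU₁0 x y))
    (fun _ y => sum_nonneg fun x _ => mul_nonneg (hP.1 x) (hU₂0 x y))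
    (fun _ _ h => outputDist_pos hP.1 hU₁0 h) (fun _ _ h => outputDist_pos hP.1 hU₂0 h)
  simp only [← hq] at hI
  have hB : crossEntropy P (fun x y => s * U₁ x y + t * U₂ x y) W =
      s * crossEntropy P U₁ W + t * crossEntropy P U₂ W := by
    simp only [crossEntropy, mul_sum, ← sum_add_distrib]
    exact sum_congr rfl fun x _ => sum_congr rfl fun y _ => by ring
  refine ⟨fun x y => s * U₁ x y + t * U₂ x y, fun x => ?_, ?_, ?_, ?_⟩
  · exact convex_stdSimplex ℝ Y (hU₁ x) (hU₂ x) hs.le ht.le hst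
  · intro x y h
    by_cases h1 : P x * U₁ x y = 0
    · exact hd₂ x y fun h2 => h (by linear_combination s * h1 + t * h2)
    · exact hd₁ x y h1
  -- `B` is linear in the channel and the positive part is convex.
  · have hm : max 0 (crossEntropy P (fun x y => s * U₁ x y + t * U₂ x y) W - K) ≤
        s * max 0 (crossEntropy P U₁ W - K) + t * max 0 (crossEntropy P U₂ W - K) := by
      have k1 := mul_le_mul_of_nonneg_left (le_max_right 0 (crossEntropy P U₁ W - K)) hs.le
      have k2 := mul_le_mul_of_nonneg_left (le_max_right 0 (crossEntropy P U₂ W - K)) ht.le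
      have k3 : K = s * K + t * K := by rw [← add_mul, hst, one_mul]
      refine max_le (by positivity) ?_
      rw [hB]
      linarith
    have k1 := mul_le_mul_of_nonneg_left hI₁ hs.le
    have k2 := mul_le_mul_of_nonneg_left hI₂ ht.le
    unfold outputEntropy at *
    linarith
  · have k1 := mul_lt_mul_of_pos_left hD₁ hs
    have k2 := mul_lt_mul_of_pos_left hD₂ ht
    linarith

theorem errorExp_antitone (W : X → Y → ℝ) (K : ℝ) : Antitone fun R : ℝ => errorExp W R K := by
  intro R R' h
  refine iSup₂_mono fun P _ => biInf_mono fun U hU => ⟨hU.1, hU.2.trans ?_⟩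
  exact_mod_cast h

end Information

/-! ### Types of blocks and joint types. -/

section Types

/-- The type of a block: the number of occurrences of each letter. -/
noncomputable def letterCount {A : Type*} {n : ℕ} (z : Fin n → A) (a : A) : Fin (n + 1) := by
  classical
  exact ⟨(univ.filter fun i => z i = a).card,
    Nat.lt_succ_of_le ((card_filter_le _ _).trans (by simp))⟩

theorem sum_comp_eq_sum_letterCount {A : Type*} [Fintype A] {n : ℕ} (z : Fin n → A) (f : A → ℝ) :
    ∑ i, f (z i) = ∑ a, ((letterCount z a : ℕ) : ℝ) * f a := by
  classical
  rw [← sum_fiberwise_of_maps_to (s := univ) (t := univ) (g := z) (fun _ _ => mem_univ _)]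
  refine sum_congr rfl fun a _ => ?_
  rw [sum_congr rfl (g := fun _ => f a) (fun i hi => by rw [(mem_filter.1 hi).2]), sum_const,
    nsmul_eq_mul]
  simp only [letterCount]

theorem letterCount_ne_zero {A : Type*} {n : ℕ} (z : Fin n → A) (a : A) :
    (letterCount z a : ℕ) ≠ 0 ↔ ∃ i, z i = a := by
  classical
  simp only [letterCount]
  rw [← Nat.pos_iff_ne_zero, card_pos]
  simp [Finset.Nonempty]

variable {X Y : Type*} [Fintype Y] {n : ℕ}

/-- The joint type of two blocks. -/
noncomputable def jointCount (x : Fin n → X) (y : Fin n → Y) : X × Y → Fin (n + 1) :=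
  letterCount fun i => (x i, y i)

/-- The input distribution of a joint type. -/
noncomputable def inputOf (τ : X × Y → Fin (n + 1)) (x : X) : ℝ :=
  (∑ y, ((τ (x, y) : ℕ) : ℝ)) / n

open Classical in
/-- The conditional distribution of a joint type, equal to `W` for letters that do not occur. -/
noncomputable def channelOf (W : X → Y → ℝ) (τ : X × Y → Fin (n + 1)) (x : X) (y : Y) : ℝ :=
  if ∑ y, ((τ (x, y) : ℕ) : ℝ) = 0 then W x y
  else ((τ (x, y) : ℕ) : ℝ) / ∑ y, ((τ (x, y) : ℕ) : ℝ)

theorem inputOf_mul_channelOf (W : X → Y → ℝ) (τ : X × Y → Fin (n + 1)) (x : X) (y : Y) :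
    inputOf τ x * channelOf W τ x y = ((τ (x, y) : ℕ) : ℝ) / n := by
  unfold inputOf channelOf
  split_ifs with h
  · have h1 : ((τ (x, y) : ℕ) : ℝ) = 0 :=
      (sum_eq_zero_iff_of_nonneg fun _ _ => Nat.cast_nonneg _).1 h y (mem_univ y)
    rw [h, h1, zero_div, zero_mul]
  · field_simp

theorem channelOf_mem {W : X → Y → ℝ} (hW : ∀ x, W x ∈ stdSimplex ℝ Y)
    (τ : X × Y → Fin (n + 1)) : channelOf W τ ∈ channels X Y := by
  intro x
  constructor
  · intro y
    unfold channelOf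
    split_ifs with h
    · exact (hW x).1 y
    · exact div_nonneg (Nat.cast_nonneg _) (sum_nonneg fun _ _ => Nat.cast_nonneg _)
  · unfold channelOf
    by_cases h : ∑ y, ((τ (x, y) : ℕ) : ℝ) = 0
    · simp only [h, if_true]
      exact (hW x).2
    · simp only [h, if_false]
      rw [← sum_div, div_self h]

variable [Fintype X]

theorem sum_comp_jointCount (W : X → Y → ℝ) (hn : 0 < n) (x : Fin n → X) (y : Fin n → Y)
    (f : X → Y → ℝ) :
    ∑ i, f (x i) (y i) = n * ∑ a, ∑ b, inputOf (jointCount x y) a *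
      channelOf W (jointCount x y) a b * f a b := by
  have h := sum_comp_eq_sum_letterCount (fun i => (x i, y i)) fun p => f p.1 p.2
  have hn' : (n : ℝ) ≠ 0 := by positivity
  simp only [inputOf_mul_channelOf, mul_sum]
  rw [h, Fintype.sum_prod_type]
  refine sum_congr rfl fun a _ => sum_congr rfl fun b _ => ?_
  simp only [jointCount]
  field_simp

theorem inputOf_mem (hn : 0 < n) (x : Fin n → X) (y : Fin n → Y) :
    inputOf (jointCount x y) ∈ stdSimplex ℝ X := by
  refine ⟨fun a => div_nonneg (sum_nonneg fun _ _ => Nat.cast_nonneg _) (Nat.cast_nonneg _), ?_⟩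
  have h := sum_comp_eq_sum_letterCount (fun i => (x i, y i)) fun _ => 1
  have hn' : (n : ℝ) ≠ 0 := by positivity
  simp only [inputOf, ← sum_div]
  rw [div_eq_one_iff_eq hn',
    ← Fintype.sum_prod_type' (f := fun a b => ((jointCount x y (a, b) : ℕ) : ℝ))]
  simpa [jointCount] using h.symm

theorem prod_eq_exp_sum_log {ι : Type*} [Fintype ι] {g : ι → ℝ} (h : ∀ i, 0 < g i) :
    ∏ i, g i = Real.exp (-∑ i, -Real.log (g i)) := by
  rw [← sum_neg_distrib, Real.exp_sum]
  exact prod_congr rfl fun i _ => by rw [neg_neg, Real.exp_log (h i)]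

/-- The probability of `y` given `x` under a channel `V` that dominates the joint type. -/
theorem prod_jointCount (W : X → Y → ℝ) (hn : 0 < n) (x : Fin n → X) (y : Fin n → Y)
    {V : X → Y → ℝ}
    (hV : IsDominated V (inputOf (jointCount x y)) (channelOf W (jointCount x y))) :
    blockProb V x y = Real.exp (-(n * crossEntropy (inputOf (jointCount x y))
      (channelOf W (jointCount x y)) V)) := by
  unfold blockProb crossEntropy
  rw [prod_eq_exp_sum_log, sum_comp_jointCount W hn x y fun a b => -Real.log (V a b)]
  intro i
  refine hV _ _ ?_
  rw [inputOf_mul_channelOf]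
  have h1 := (letterCount_ne_zero (fun i => (x i, y i)) (x i, y i)).2 ⟨i, rfl⟩
  have h2 : ((jointCount x y (x i, y i) : ℕ) : ℝ) ≠ 0 := by exact_mod_cast h1
  positivity

theorem sum_outputDist {P : X → ℝ} {U : X → Y → ℝ} (hP : ∑ x, P x = 1)
    (hU : ∀ x, ∑ y, U x y = 1) : ∑ y, outputDist P U y = 1 := by
  unfold outputDist
  rw [sum_comm]
  simp [← mul_sum, hU, hP]

end Types

/-! ### Upper bound on the probability of correct decoding. -/

section CorrectDecoding

variable {X Y : Type*} [Fintype X] [Fintype Y] [DecidableEq Y] {n M L : ℕ} {W : X → Y → ℝ}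

open Classical in
/-- The contribution of a joint type to the probability of correct decoding. -/
theorem sum_instanceMean_sup_le (hW : ∀ x, W x ∈ stdSimplex ℝ Y) {R K : ℝ} (hR : 0 < R)
    (hn : 0 < n) (hM : 0 < M) (hL : 0 < L) (hM1 : (M : ℝ) ≤ Real.exp (n * R))
    (hM2 : Real.exp (n * R) ≤ 2 * M) (hL2 : Real.exp (n * K) ≤ 2 * L)
    (C : Codebook X n M) (τ : X × Y → Fin (n + 1)) {a : ℝ} (ha : (a : EReal) ≤ correctExp W R K) :
    ∑ y, instanceMean W C (fun ω : Instance Y n M L =>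
      (((univ.filter fun m => jointCount (C m) y = τ).sup fun m => replicas ω m y : ℕ) : ℝ)) ≤
      (M * L) * ((4 * (n * R) + 8) * Real.exp (-(n * a))) := by
  have hW0 : ∀ x y, 0 ≤ W x y := fun x => (hW x).1
  have hW1 : ∀ x, ∑ y, W x y = 1 := fun x => (hW x).2
  have hMp : (0 : ℝ) < M := by positivity
  have hLp : (0 : ℝ) < L := by positivity
  have hnp : (0 : ℝ) < n := by positivity
  have hsum := fun y => instanceMean_sup_le_sum (L := L) hW0 hW1 C
    (univ.filter fun m => jointCount (C m) y = τ) y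
  -- A joint type that never occurs, or that charges a transition of probability 0, contributes
  -- nothing. Otherwise it defines a genuine pair `(P, U)` dominated by `W`.
  by_cases hex : ∃ m y, jointCount (C m) y = τ
  swap
  · push Not at hex
    refine (sum_nonpos fun y _ => (hsum y).trans (le_of_eq ?_)).trans (by positivity)
    simp [hex]
  by_cases hd : ∀ p, (τ p : ℕ) ≠ 0 → 0 < W p.1 p.2
  swap
  · push Not at hd
    obtain ⟨p, hp, hWp⟩ := hd
    refine (sum_nonpos fun y _ => (hsum y).trans (le_of_eq ?_)).trans (by positivity)
    refine sum_eq_zero fun m hm => ?_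
    rw [← (mem_filter.1 hm).2] at hp
    obtain ⟨i, hi⟩ := (letterCount_ne_zero (fun i => (C m i, y i)) p).1 hp
    have h0 : W (C m i) (y i) = 0 := by
      have := le_antisymm hWp (hW0 _ _)
      rwa [← hi] at this
    rw [blockProb, prod_eq_zero (mem_univ i) h0, mul_zero]
  obtain ⟨m₀, y₀, h₀⟩ := hex
  set P := inputOf τ with hPdef
  set U := channelOf W τ with hUdef
  have hP : P ∈ stdSimplex ℝ X := by
    rw [hPdef, ← h₀]
    exact inputOf_mem hn _ _
  have hU : U ∈ channels X Y := channelOf_mem hW τ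
  have hU0 : ∀ x y, 0 ≤ U x y := fun x => (hU x).1
  have hdom : IsDominated W P U := by
    intro x y h
    refine hd (x, y) fun h0 => h ?_
    rw [hPdef, hUdef, inputOf_mul_channelOf, h0]
    simp
  have hdU : IsDominated U P U := fun x y h =>
    lt_of_le_of_ne (hU0 x y) (right_ne_zero_of_mul h).symm
  have hdQ : IsDominated (fun _ : X => outputDist P U) P U := fun x y h =>
    outputDist_pos hP.1 hU0 h
  have prodV : ∀ V : X → Y → ℝ, IsDominated V P U → ∀ m y, jointCount (C m) y = τ →
      blockProb V (C m) y = Real.exp (-(n * crossEntropy P U V)) := by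
    intro V hV m y h
    have := prod_jointCount W hn (C m) y (V := V)
    rw [h] at this
    exact this hV
  -- The joint type itself is the pair tested in the minimum defining `correctExp`.
  have hcorr := EReal.coe_le_coe_iff.1 (ha.trans (correctExp_le hP hU hdom))
  set B := crossEntropy P U W
  set H₁ := crossEntropy P U U
  set H₂ := outputEntropy P U with hH₂
  -- For fixed `m`, each such `y` has probability exactly `e^{-nH₁}` under `U`, and the total is at
  -- most 1.
  have hcard : ∑ y, ((univ.filter fun m => jointCount (C m) y = τ).card : ℝ) ≤
      M * Real.exp (n * H₁) := by
    have h1 : (∑ y, ((univ.filter fun m => jointCount (C m) y = τ).card : ℝ)) *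
        Real.exp (-(n * H₁)) ≤ M := by
      rw [sum_mul]
      calc ∑ y, ((univ.filter fun m => jointCount (C m) y = τ).card : ℝ) * Real.exp (-(n * H₁))
          ≤ ∑ y, ∑ m, blockProb U (C m) y := by
            refine sum_le_sum fun y _ => ?_
            rw [← nsmul_eq_mul, ← sum_const]
            refine (sum_le_sum fun m hm => (prodV U hdU m y (mem_filter.1 hm).2).ge).trans ?_
            exact sum_le_sum_of_subset_of_nonneg (filter_subset _ _)
              fun m _ _ => blockProb_nonneg hU0 _ _
        _ = M := by
            rw [sum_comm]
            simp [sum_blockProb fun x => (hU x).2]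
    rw [Real.exp_neg, ← div_eq_mul_inv, div_le_iff₀ (Real.exp_pos _)] at h1
    exact h1
  have hcard2 : ((univ.filter fun y => ∃ m, jointCount (C m) y = τ).card : ℝ) ≤
      Real.exp (n * H₂) := by
    have h1 : ((univ.filter fun y => ∃ m, jointCount (C m) y = τ).card : ℝ) *
        Real.exp (-(n * H₂)) ≤ 1 := by
      rw [← nsmul_eq_mul, ← sum_const, ← sum_blockProb (W := fun _ : X => outputDist P U)
        (fun _ => sum_outputDist hP.2 fun x => (hU x).2) (C m₀)]
      refine (sum_le_sum fun y hy => ?_).trans (sum_le_sum_of_subset_of_nonneg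
        (filter_subset _ _) fun y _ _ => blockProb_nonneg (fun _ y => sum_nonneg
          fun x _ => mul_nonneg (hP.1 x) (hU0 x y)) _ _)
      obtain ⟨m, hm⟩ := (mem_filter.1 hy).2
      exact (prodV (fun _ : X => outputDist P U) hdQ m y hm).ge
    rw [Real.exp_neg, ← div_eq_mul_inv, div_le_iff₀ (Real.exp_pos _), one_mul] at h1
    exact h1
  have bound1 : ∑ y, instanceMean W C (fun ω : Instance Y n M L =>
      (((univ.filter fun m => jointCount (C m) y = τ).sup fun m => replicas ω m y : ℕ) : ℝ)) ≤
      (M * L) * Real.exp (-(n * (B - H₁))) := by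
    calc _ ≤ ∑ y, ((univ.filter fun m => jointCount (C m) y = τ).card : ℝ) *
          (L * Real.exp (-(n * B))) := by
            refine sum_le_sum fun y _ => (hsum y).trans (le_of_eq ?_)
            rw [← nsmul_eq_mul, ← sum_const]
            exact sum_congr rfl fun m hm => by rw [prodV W hdom m y (mem_filter.1 hm).2]
      _ ≤ (M * Real.exp (n * H₁)) * (L * Real.exp (-(n * B))) := by
            rw [← sum_mul]
            gcongr
      _ = _ := by
            rw [show -(n * (B - H₁)) = n * H₁ + -(n * B) by ring, Real.exp_add]
            ring
  have hlogM : Real.log M ≤ n * R := by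
    rw [← Real.log_exp (n * R)]
    exact Real.log_le_log hMp hM1
  have bound2 : ∑ y, instanceMean W C (fun ω : Instance Y n M L =>
      (((univ.filter fun m => jointCount (C m) y = τ).sup fun m => replicas ω m y : ℕ) : ℝ)) ≤
      Real.exp (n * H₂) * (n * R + 2 * (L * Real.exp (-(n * B)))) := by
    calc _ ≤ ∑ y, if ∃ m, jointCount (C m) y = τ then
          n * R + 2 * (L * Real.exp (-(n * B))) else 0 := by
            refine sum_le_sum fun y _ => ?_
            split_ifs with hy
            · obtain ⟨m, hm⟩ := hy
              refine (instanceMean_sup_le_log hW0 hW1 C _ ⟨m, by simpa using hm⟩ y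
                (L * Real.exp (-(n * B))) fun m hm => ?_).trans (by linarith)
              rw [prodV W hdom m y (mem_filter.1 hm).2]
            · push Not at hy
              refine (hsum y).trans (le_of_eq ?_)
              simp [hy]
      _ ≤ _ := by
            rw [← sum_filter, sum_const, nsmul_eq_mul]
            gcongr
  -- If the outer positive part is 0, the exponent `D` of `bound1` suffices. Otherwise the target is
  -- `R - H₂ + min(B, K)`, and its two upper bounds `R + K - H₂` and `R + B - H₂` match the two
  -- summands of `bound2`.
  rcases max_cases 0 (R - (H₂ - H₁) - max 0 (B - K)) with ⟨he, -⟩ | ⟨he, -⟩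
  · rw [he, add_zero] at hcorr
    refine bound1.trans (mul_le_mul_of_nonneg_left ?_ (by positivity))
    calc Real.exp (-(n * (B - H₁))) ≤ 1 * Real.exp (-(n * a)) := by
          rw [one_mul]
          gcongr
      _ ≤ _ := by
          gcongr
          have : 0 ≤ n * R := by positivity
          linarith
  · rw [he] at hcorr
    have h1 : a ≤ R + K - H₂ := by
      have := le_max_right 0 (B - K)
      linarith
    have h2 : a ≤ R + B - H₂ := by
      have := le_max_left 0 (B - K)
      linarith
    refine bound2.trans ?_
    have e1 : Real.exp (n * H₂) ≤ Real.exp (-(n * a)) * (Real.exp (n * R) * Real.exp (n * K)) := by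
      rw [← Real.exp_add, ← Real.exp_add]
      refine Real.exp_le_exp.2 ?_
      nlinarith
    have e2 : Real.exp (n * H₂) * Real.exp (-(n * B)) ≤ Real.exp (-(n * a)) * Real.exp (n * R) := by
      rw [← Real.exp_add, ← Real.exp_add]
      refine Real.exp_le_exp.2 ?_
      nlinarith
    have hE := Real.exp_pos (-(n * a))
    have e3 : Real.exp (n * R) * Real.exp (n * K) ≤ 4 * (M * L) := by
      calc _ ≤ (2 * M) * (2 * (L : ℝ)) := by gcongr
        _ = _ := by ring
    calc Real.exp (n * H₂) * (n * R + 2 * (L * Real.exp (-(n * B))))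
        = n * R * Real.exp (n * H₂) + 2 * L * (Real.exp (n * H₂) * Real.exp (-(n * B))) := by ring
      _ ≤ n * R * (Real.exp (-(n * a)) * (4 * (M * L))) +
          2 * L * (Real.exp (-(n * a)) * (2 * M)) := by
          have e4 := e1.trans (mul_le_mul_of_nonneg_left e3 hE.le)
          have e5 := e2.trans (mul_le_mul_of_nonneg_left hM2 hE.le)
          gcongr
      _ ≤ _ := by
          have : 0 ≤ M * L * Real.exp (-(n * a)) := by positivity
          linarith

/-- Upper bound on the probability of correct decoding of an arbitrary codebook. -/
theorem one_sub_errorProb_le (hW : ∀ x, W x ∈ stdSimplex ℝ Y) {R K : ℝ} (hR : 0 < R)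
    (hn : 0 < n) (hM : 0 < M) (hL : 0 < L) (hM1 : (M : ℝ) ≤ Real.exp (n * R))
    (hM2 : Real.exp (n * R) ≤ 2 * M) (hL2 : Real.exp (n * K) ≤ 2 * L)
    (C : Codebook X n M) {a : ℝ} (ha : (a : EReal) ≤ correctExp W R K) :
    1 - errorProb W C L ≤ ((n : ℝ) + 1) ^ (Fintype.card X * Fintype.card Y) *
      (4 * (n * R) + 8) * Real.exp (-(n * a)) := by
  classical
  have hMp : (0 : ℝ) < M := by positivity
  have hLp : (0 : ℝ) < L := by positivity
  rw [one_sub_errorProb_eq (fun x => (hW x).2) C hM hL, one_div, inv_mul_le_iff₀ (by positivity)]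
  -- The overall maximum is at most the sum over joint types of the maxima within each type, and
  -- there are `(n + 1)^(|X||Y|)` count functions.
  calc ∑ y, instanceMean W C
        (fun ω : Instance Y n M L => ((univ.sup fun m => replicas ω m y : ℕ) : ℝ))
      ≤ ∑ y, instanceMean W C (fun ω : Instance Y n M L => ∑ τ : X × Y → Fin (n + 1),
          (((univ.filter fun m => jointCount (C m) y = τ).sup fun m => replicas ω m y : ℕ) :
            ℝ)) := by
        refine sum_le_sum fun y _ => instanceMean_mono (fun x => (hW x).1) C fun ω => ?_
        rw [← Nat.cast_sum]
        refine Nat.cast_le.2 (Finset.sup_le fun m _ => ?_)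
        have h1 : replicas ω m y ≤ (univ.filter fun m' => jointCount (C m') y =
            jointCount (C m) y).sup fun m => replicas ω m y :=
          le_sup (f := fun m => replicas ω m y) (by simp)
        exact h1.trans (single_le_sum (f := fun τ : X × Y → Fin (n + 1) =>
          (univ.filter fun m => jointCount (C m) y = τ).sup fun m => replicas ω m y)
          (fun _ _ => Nat.zero_le _) (mem_univ _))
    _ = ∑ τ : X × Y → Fin (n + 1), ∑ y, instanceMean W C (fun ω : Instance Y n M L =>
          (((univ.filter fun m => jointCount (C m) y = τ).sup fun m => replicas ω m y : ℕ) :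
            ℝ)) := by
        simp only [instanceMean_sum]
        exact sum_comm
    _ ≤ ∑ _τ : X × Y → Fin (n + 1), (M * L) * ((4 * (n * R) + 8) * Real.exp (-(n * a))) :=
        sum_le_sum fun τ _ => sum_instanceMean_sup_le hW hR hn hM hL hM1 hM2 hL2 C τ ha
    _ = _ := by
        rw [sum_const, nsmul_eq_mul, card_univ]
        simp only [Fintype.card_fun, Fintype.card_prod, Fintype.card_fin]
        push_cast
        ring

end CorrectDecoding

/-! ### Typical outputs of a codeword of given composition. -/

section Chebyshev

variable {X Y : Type*} [Fintype Y] {n : ℕ}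

/-- The variance of a sum of independent centred variables. -/
theorem sum_prod_mul_sum_sq {p h : Fin n → Y → ℝ} (hp : ∀ i, ∑ b, p i b = 1)
    (hc : ∀ i, ∑ b, p i b * h i b = 0) :
    ∑ y : Fin n → Y, (∏ i, p i (y i)) * (∑ i, h i (y i)) ^ 2 = ∑ i, ∑ b, p i b * h i b ^ 2 := by
  have key : ∀ i j, ∑ y : Fin n → Y, (∏ i, p i (y i)) * (h i (y i) * h j (y j)) =
      if i = j then ∑ b, p i b * h i b ^ 2 else 0 := by
    intro i j
    have e := sum_pi_prod
      (fun k b => p k b * ((if k = i then h k b else 1) * (if k = j then h k b else 1)))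
    simp only [prod_mul_distrib, prod_ite_eq', mem_univ, if_true] at e
    rw [e]
    split_ifs with hij
    · subst hij
      rw [Fintype.prod_eq_single i fun k hk => by simp [hk, hp]]
      exact sum_congr rfl fun b _ => by simp [sq]
    · refine prod_eq_zero (mem_univ i) ?_
      simpa [hij] using hc i
  have expand : ∀ y : Fin n → Y, (∏ i, p i (y i)) * (∑ i, h i (y i)) ^ 2 =
      ∑ i, ∑ j, (∏ i, p i (y i)) * (h i (y i) * h j (y j)) := by
    intro y
    rw [sq, sum_mul_sum]
    simp only [mul_sum]
  simp only [expand]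
  rw [sum_comm]
  refine sum_congr rfl fun i _ => ?_
  rw [sum_comm]
  simp only [key, sum_ite_eq, mem_univ, if_true]

variable [Fintype X]

/-- Chebyshev's inequality: the letters of `y` are independent given `x`, and each variance is at
most the second moment. The hypothesis `hx`, that `x` has composition `P`, turns sums over positions
into `n` times averages. -/
theorem sum_blockProb_deviation_le {P : X → ℝ} {U : X → Y → ℝ} (hU : U ∈ channels X Y)
    (hn : 0 < n) {x : Fin n → X} (hx : ∀ g : X → ℝ, ∑ i, g (x i) = n * ∑ a, P a * g a)
    (f : X → Y → ℝ) {V ε : ℝ} (hε : 0 < ε) (hV : ∑ a, ∑ b, P a * U a b * f a b ^ 2 ≤ V) :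
    ∑ y ∈ univ.filter (fun y : Fin n → Y =>
      n * ε ≤ |∑ i, f (x i) (y i) - n * ∑ a, ∑ b, P a * U a b * f a b|), blockProb U x y ≤
      V / (n * ε ^ 2) := by
  have hU0 : ∀ x y, 0 ≤ U x y := fun x => (hU x).1
  have hnp : (0 : ℝ) < n := by positivity
  set m : X → ℝ := fun a => ∑ b, U a b * f a b with hm
  set F := ∑ a, ∑ b, P a * U a b * f a b with hF
  have hmF : ∑ i, m (x i) = n * F := by
    rw [hx m, hF]
    simp only [hm, mul_sum, mul_assoc]
  have hsq := sum_prod_mul_sum_sq (p := fun i => U (x i)) (h := fun i b => f (x i) b - m (x i))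
    (fun i => (hU (x i)).2) (fun i => by
      simp only [mul_sub, sum_sub_distrib, ← sum_mul, (hU (x i)).2, one_mul]
      simp [hm])
  have hvar : ∑ i, ∑ b, U (x i) b * (f (x i) b - m (x i)) ^ 2 ≤ n * V := by
    calc ∑ i, ∑ b, U (x i) b * (f (x i) b - m (x i)) ^ 2
        ≤ ∑ i, ∑ b, U (x i) b * f (x i) b ^ 2 := by
          refine sum_le_sum fun i _ => ?_
          have e1 : ∑ b, U (x i) b * (f (x i) b - m (x i)) ^ 2 =
              ∑ b, U (x i) b * f (x i) b ^ 2 - 2 * m (x i) * (∑ b, U (x i) b * f (x i) b) +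
                m (x i) ^ 2 * ∑ b, U (x i) b := by
            simp only [mul_sum, ← sum_sub_distrib, ← sum_add_distrib]
            exact sum_congr rfl fun b _ => by ring
          have e2 : ∑ b, U (x i) b * f (x i) b = m (x i) := rfl
          rw [e1, (hU (x i)).2, e2]
          nlinarith [sq_nonneg (m (x i))]
      _ = n * ∑ a, ∑ b, P a * U a b * f a b ^ 2 := by
          rw [hx fun a => ∑ b, U a b * f a b ^ 2]
          simp only [mul_sum, mul_assoc]
      _ ≤ n * V := by gcongr
  have hmain : (∑ y ∈ univ.filter (fun y : Fin n → Y =>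
      n * ε ≤ |∑ i, f (x i) (y i) - n * F|), blockProb U x y) * (n * ε) ^ 2 ≤ n * V := by
    rw [sum_mul]
    refine le_trans ?_ (hsq.le.trans hvar)
    refine (sum_le_sum fun y hy => ?_).trans (sum_le_sum_of_subset_of_nonneg (filter_subset _ _)
      fun y _ _ => mul_nonneg (blockProb_nonneg hU0 x y) (sq_nonneg _))
    refine mul_le_mul_of_nonneg_left ?_ (blockProb_nonneg hU0 x y)
    rw [sum_sub_distrib, hmF, ← sq_abs (_ - _)]
    exact pow_le_pow_left₀ (by positivity) (mem_filter.1 hy).2 2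
  rw [le_div_iff₀ (by positivity)]
  have : (0 : ℝ) < n := hnp
  nlinarith

/-- Keeps second moments of log-probabilities bounded although the logarithm blows up at 0; it is
the square of `|log t| √t ≤ 2`. -/
theorem mul_log_sq_le {t : ℝ} (h0 : 0 ≤ t) (h1 : t ≤ 1) : t * Real.log t ^ 2 ≤ 4 := by
  rcases h0.eq_or_lt with rfl | h0
  · simp
  have h := Real.abs_log_mul_self_rpow_lt t (1 / 2) h0 h1 (by norm_num)
  rw [← Real.sqrt_eq_rpow] at h
  have h2 : (Real.log t * √t) ^ 2 ≤ 2 ^ 2 := by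
    rw [← sq_abs]
    exact pow_le_pow_left₀ (abs_nonneg _) (h.le.trans (by norm_num)) 2
  rw [mul_pow, Real.sq_sqrt h0.le] at h2
  linarith

/-- A bound on the second moments of all the information densities. -/
noncomputable def momentBound (W : X → Y → ℝ) : ℝ :=
  4 * Fintype.card Y + ∑ x, ∑ y, Real.log (W x y) ^ 2

theorem simplex_le_one {A : Type*} [Fintype A] {p : A → ℝ} (hp : p ∈ stdSimplex ℝ A) (a : A) :
    p a ≤ 1 := by
  rw [← hp.2]
  exact single_le_sum (fun a _ => hp.1 a) (mem_univ a)

theorem outputDist_mem {P : X → ℝ} {U : X → Y → ℝ} (hP : P ∈ stdSimplex ℝ X)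
    (hU : U ∈ channels X Y) : outputDist P U ∈ stdSimplex ℝ Y :=
  ⟨fun y => sum_nonneg fun x _ => mul_nonneg (hP.1 x) ((hU x).1 y),
    sum_outputDist hP.2 fun x => (hU x).2⟩

/-- The bound depends on neither `P` nor `U`, so the block length needed for typicality is uniform
over compositions, which change with `n`. -/
theorem moment_self_le (W : X → Y → ℝ) {P : X → ℝ} {U : X → Y → ℝ} (hP : P ∈ stdSimplex ℝ X)
    (hU : U ∈ channels X Y) :
    ∑ a, ∑ b, P a * U a b * (-Real.log (U a b)) ^ 2 ≤ momentBound W := by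
  calc ∑ a, ∑ b, P a * U a b * (-Real.log (U a b)) ^ 2 ≤ ∑ a, ∑ _b : Y, P a * 4 := by
        refine sum_le_sum fun a _ => sum_le_sum fun b _ => ?_
        rw [neg_sq, mul_assoc]
        exact mul_le_mul_of_nonneg_left (mul_log_sq_le ((hU a).1 b) (simplex_le_one (hU a) b))
          (hP.1 a)
    _ = 4 * Fintype.card Y := by
        rw [sum_comm]
        simp [← sum_mul, hP.2, mul_comm]
    _ ≤ _ := le_add_of_nonneg_right (sum_nonneg fun _ _ => sum_nonneg fun _ _ => sq_nonneg _)

theorem moment_channel_le (W : X → Y → ℝ) {P : X → ℝ} {U : X → Y → ℝ} (hP : P ∈ stdSimplex ℝ X)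
    (hU : U ∈ channels X Y) :
    ∑ a, ∑ b, P a * U a b * (-Real.log (W a b)) ^ 2 ≤ momentBound W := by
  refine le_trans (sum_le_sum fun a _ => sum_le_sum fun b _ => ?_)
    (le_add_of_nonneg_left (by positivity))
  rw [neg_sq]
  exact mul_le_of_le_one_left (sq_nonneg _)
    (mul_le_one₀ (simplex_le_one hP a) ((hU a).1 b) (simplex_le_one (hU a) b))

theorem moment_output_le (W : X → Y → ℝ) {P : X → ℝ} {U : X → Y → ℝ} (hP : P ∈ stdSimplex ℝ X)
    (hU : U ∈ channels X Y) :
    ∑ a, ∑ b, P a * U a b * (-Real.log (outputDist P U b)) ^ 2 ≤ momentBound W := by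
  have hQ := outputDist_mem hP hU
  calc ∑ a, ∑ b, P a * U a b * (-Real.log (outputDist P U b)) ^ 2
      = ∑ b, outputDist P U b * Real.log (outputDist P U b) ^ 2 := by
        rw [sum_comm]
        refine sum_congr rfl fun b _ => ?_
        rw [← sum_mul, neg_sq]
        rfl
    _ ≤ ∑ _b : Y, 4 := sum_le_sum fun b _ => mul_log_sq_le (hQ.1 b) (simplex_le_one hQ b)
    _ = 4 * Fintype.card Y := by simp [mul_comm]
    _ ≤ _ := le_add_of_nonneg_right (sum_nonneg fun _ _ => sum_nonneg fun _ _ => sq_nonneg _)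

/-- The output blocks that are jointly typical with `x` under the channel `U`. -/
noncomputable def typicalSet (W : X → Y → ℝ) (P : X → ℝ) (U : X → Y → ℝ) (ε : ℝ)
    (x : Fin n → X) : Finset (Fin n → Y) :=
  univ.filter fun y => (∀ i, 0 < U (x i) (y i)) ∧
    |∑ i, -Real.log (U (x i) (y i)) - n * crossEntropy P U U| < n * ε ∧
    |∑ i, -Real.log (W (x i) (y i)) - n * crossEntropy P U W| < n * ε ∧
    |∑ i, -Real.log (outputDist P U (y i)) - n * outputEntropy P U| < n * ε

theorem half_le_sum_typicalSet (W : X → Y → ℝ) {P : X → ℝ} {U : X → Y → ℝ}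
    (hP : P ∈ stdSimplex ℝ X) (hU : U ∈ channels X Y) (hn : 0 < n) {x : Fin n → X}
    (hx : ∀ g : X → ℝ, ∑ i, g (x i) = n * ∑ a, P a * g a) {ε : ℝ} (hε : 0 < ε)
    (hnε : 6 * momentBound W ≤ n * ε ^ 2) :
    1 / 2 ≤ ∑ y ∈ typicalSet W P U ε x, blockProb U x y := by
  classical
  have hU0 : ∀ x y, 0 ≤ U x y := fun x => (hU x).1
  have hnp : (0 : ℝ) < n := by positivity
  have d1 := sum_blockProb_deviation_le hU hn hx _ hε (moment_self_le W hP hU)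
  have d2 := sum_blockProb_deviation_le hU hn hx _ hε (moment_channel_le W hP hU)
  have d3 := sum_blockProb_deviation_le hU hn hx _ hε (moment_output_le W hP hU)
  -- Three deviation events of probability at most 1/6 each leave at least 1/2.
  have hv : momentBound W / (n * ε ^ 2) ≤ 1 / 6 := by
    rw [div_le_iff₀ (by positivity)]
    linarith
  have hsum := sum_blockProb (fun x => (hU x).2) x
  have hle : ∑ y, blockProb U x y ≤ ∑ y, (
      (if y ∈ typicalSet W P U ε x then blockProb U x y else 0) +
      (if n * ε ≤ |∑ i, -Real.log (U (x i) (y i)) - n * crossEntropy P U U| then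
        blockProb U x y else 0) +
      (if n * ε ≤ |∑ i, -Real.log (W (x i) (y i)) - n * crossEntropy P U W| then
        blockProb U x y else 0) +
      (if n * ε ≤ |∑ i, -Real.log (outputDist P U (y i)) - n * outputEntropy P U| then
        blockProb U x y else 0)) := by
    refine sum_le_sum fun y _ => ?_
    have hb := blockProb_nonneg hU0 x y
    -- The positivity clause of the typical set costs nothing: blocks violating it have probability
    -- 0.
    by_cases h0 : ∀ i, 0 < U (x i) (y i)
    · simp only [typicalSet, mem_filter, mem_univ, true_and, h0, implies_true]
      split_ifs <;> first | linarith | (exfalso; simp_all)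
    · push Not at h0
      obtain ⟨i, hi⟩ := h0
      have : blockProb U x y = 0 := prod_eq_zero (mem_univ i) (le_antisymm hi (hU0 _ _))
      simp [this]
  simp only [sum_add_distrib, ← sum_filter] at hle
  rw [hsum, filter_mem_eq_inter, univ_inter] at hle
  unfold outputEntropy crossEntropy at hle
  linarith

section Typical

variable {W : X → Y → ℝ} {P : X → ℝ} {U : X → Y → ℝ} {ε : ℝ} {x : Fin n → X} {y : Fin n → Y}

theorem blockProb_self_le (hy : y ∈ typicalSet W P U ε x) :
    blockProb U x y ≤ Real.exp (-(n * (crossEntropy P U U - ε))) := by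
  obtain ⟨-, h0, h, -⟩ := mem_filter.1 hy
  rw [blockProb, prod_eq_exp_sum_log h0]
  refine Real.exp_le_exp.2 ?_
  linarith [(abs_lt.1 h).1]

theorem blockProb_channel_mem (hx : ∀ i, 0 < P (x i)) (hd : IsDominated W P U)
    (hy : y ∈ typicalSet W P U ε x) :
    Real.exp (-(n * (crossEntropy P U W + ε))) ≤ blockProb W x y ∧
      blockProb W x y ≤ Real.exp (-(n * (crossEntropy P U W - ε))) := by
  obtain ⟨-, h0, -, h, -⟩ := mem_filter.1 hy
  rw [blockProb, prod_eq_exp_sum_log fun i => hd _ _ (mul_pos (hx i) (h0 i)).ne']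
  have := abs_lt.1 h
  constructor <;> refine Real.exp_le_exp.2 ?_ <;> linarith

theorem le_blockProb_output (hP : ∀ x, 0 ≤ P x) (hU : ∀ x y, 0 ≤ U x y) (hx : ∀ i, 0 < P (x i))
    (hy : y ∈ typicalSet W P U ε x) :
    Real.exp (-(n * (outputEntropy P U + ε))) ≤ ∏ i, outputDist P U (y i) := by
  obtain ⟨-, h0, -, -, h⟩ := mem_filter.1 hy
  rw [prod_eq_exp_sum_log fun i => outputDist_pos hP hU (mul_pos (hx i) (h0 i)).ne']
  refine Real.exp_le_exp.2 ?_
  linarith [(abs_lt.1 h).2]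

/-- A set of mass at least 1/2 whose points are all light must have many points. -/
theorem le_card_typicalSet (h : 1 / 2 ≤ ∑ y ∈ typicalSet W P U ε x, blockProb U x y) :
    1 / 2 * Real.exp (n * (crossEntropy P U U - ε)) ≤ (typicalSet W P U ε x).card := by
  have h1 := h.trans (sum_le_card_nsmul _ _ _ fun y hy => blockProb_self_le hy)
  rw [nsmul_eq_mul, Real.exp_neg, ← div_eq_mul_inv, le_div_iff₀ (Real.exp_pos _)] at h1
  exact h1

end Typical

end Chebyshev

/-! ### Lower bound on the error probability from a constant-composition subcode. -/

section ErrorLowerBound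

variable {X Y : Type*} [Fintype X] [Fintype Y] [DecidableEq Y] {n M L : ℕ} {W : X → Y → ℝ}

/-- Lower bound on the error probability of a codebook that has many codewords of the same
type `P`. -/
theorem le_errorProb (hW : ∀ x, W x ∈ stdSimplex ℝ Y) {R K ε N : ℝ}
    (hn : 0 < n) (hM : 0 < M) (hL : 0 < L) (hM1 : (M : ℝ) ≤ Real.exp (n * R))
    (hM2 : Real.exp (n * R) ≤ 2 * M) (hL2 : Real.exp (n * K) ≤ 2 * L)
    (C : Codebook X n M) (A : Finset (Fin M)) (hN : 0 < N) (hA : (M : ℝ) ≤ N * A.card)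
    {P : X → ℝ} (hP : P ∈ stdSimplex ℝ X) {U : X → Y → ℝ} (hU : U ∈ channels X Y)
    (hPA : ∀ m ∈ A, ∀ g : X → ℝ, ∑ i, g (C m i) = n * ∑ a, P a * g a)
    (hPpos : ∀ m ∈ A, ∀ i, 0 < P (C m i)) (hd : IsDominated W P U) (hε : 0 < ε)
    (hrate : outputEntropy P U - crossEntropy P U U + max 0 (crossEntropy P U W - K) + 5 * ε ≤ R)
    (hnV : 6 * momentBound W ≤ n * ε ^ 2)
    (hnN : 16 * (n * R + 1) * N * Real.exp (-(n * ε)) ≤ 1) :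
    Real.exp (-(n * (crossEntropy P U W - crossEntropy P U U + 2 * ε))) / (4 * N) ≤
      errorProb W C L := by
  classical
  have hW0 : ∀ x y, 0 ≤ W x y := fun x => (hW x).1
  have hW1 : ∀ x, ∑ y, W x y = 1 := fun x => (hW x).2
  have hU0 : ∀ x y, 0 ≤ U x y := fun x => (hU x).1
  have hMp : (0 : ℝ) < M := by positivity
  have hLp : (0 : ℝ) < L := by positivity
  have hnp : (0 : ℝ) < n := by positivity
  have hlogM : Real.log M ≤ n * R := by
    rw [← Real.log_exp (n * R)]
    exact Real.log_le_log hMp hM1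
  have hR : 0 ≤ n * R := (Real.log_natCast_nonneg M).trans hlogM
  set B := crossEntropy P U W
  set H₁ := crossEntropy P U U with hH₁
  set H₂ := outputEntropy P U
  set T : Fin M → Finset (Fin n → Y) := fun m => typicalSet W P U ε (C m) with hT
  set S : (Fin n → Y) → Finset (Fin M) := fun y => A.filter fun m => y ∈ T m with hS
  set G : Finset (Fin n → Y) := univ.filter fun y => (S y).Nonempty with hG
  -- On a typical pair the expected replica number is at least `α`; the expected maximum over `S y`
  -- is at most `β` by the logarithmic bound.
  set α : ℝ := L * Real.exp (-(n * (B + ε))) with hα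
  set β : ℝ := n * R + 2 * (L * Real.exp (-(n * (B - ε)))) with hβ
  have hα0 : 0 ≤ α := by positivity
  have hβ0 : 0 ≤ β := by positivity
  -- Only messages of the subcode for which `y` is typical are kept, which can only lower the sum
  -- minus the maximum.
  have hy : ∀ y, (S y).card * α - (if (S y).Nonempty then β else 0) ≤
      instanceMean W C (fun ω : Instance Y n M L =>
        ∑ m, (replicas ω m y : ℝ) - ((univ.sup fun m => replicas ω m y : ℕ) : ℝ)) := by
    intro y
    refine le_trans ?_ (instanceMean_mono hW0 C fun ω =>
      sum_sub_sup_mono (fun m => replicas ω m y) (S y))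
    rw [instanceMean_sub, instanceMean_sum]
    simp only [instanceMean_replicas hW1]
    have hW2 : ∀ m ∈ S y, Real.exp (-(n * (B + ε))) ≤ blockProb W (C m) y ∧
        blockProb W (C m) y ≤ Real.exp (-(n * (B - ε))) := fun m hm =>
      blockProb_channel_mem (hPpos m (mem_filter.1 hm).1) hd (mem_filter.1 hm).2
    refine sub_le_sub ?_ ?_
    · rw [← nsmul_eq_mul]
      refine card_nsmul_le_sum _ _ _ fun m hm => ?_
      exact mul_le_mul_of_nonneg_left (hW2 m hm).1 hLp.le
    · split_ifs with h
      · refine (instanceMean_sup_le_log hW0 hW1 C _ h y (L * Real.exp (-(n * (B - ε))))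
          fun m hm => ?_).trans (by linarith)
        exact mul_le_mul_of_nonneg_left (hW2 m hm).2 hLp.le
      · refine (instanceMean_sup_le_sum hW0 hW1 C _ y).trans (le_of_eq ?_)
        rw [not_nonempty_iff_eq_empty.1 h, sum_empty]
  -- Count typical pairs `(m, y)` by codeword instead of by output.
  have hScard : (A.card : ℝ) * (1 / 2 * Real.exp (n * (H₁ - ε))) ≤ ∑ y, ((S y).card : ℝ) := by
    have e : ∑ y, ((S y).card : ℝ) = ∑ m ∈ A, ((T m).card : ℝ) := by
      simp only [hS, card_filter, Nat.cast_sum, Nat.cast_ite, Nat.cast_one, Nat.cast_zero]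
      rw [sum_comm]
      simp
    rw [e, ← nsmul_eq_mul]
    refine card_nsmul_le_sum _ _ _ fun m hm => ?_
    exact le_card_typicalSet (half_le_sum_typicalSet W hP hU hn (hPA m hm) hε hnV)
  have hGcard : (G.card : ℝ) ≤ Real.exp (n * (H₂ + ε)) := by
    have h1 : (G.card : ℝ) * Real.exp (-(n * (H₂ + ε))) ≤ 1 := by
      rw [← nsmul_eq_mul, ← sum_const, ← sum_blockProb (W := fun _ : X => outputDist P U)
        (fun _ => (outputDist_mem hP hU).2) (C ⟨0, hM⟩)]
      refine (sum_le_sum fun y hy => ?_).trans (sum_le_sum_of_subset_of_nonneg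
        (filter_subset _ _) fun y _ _ => blockProb_nonneg
          (fun _ => (outputDist_mem hP hU).1) _ _)
      obtain ⟨m, hm⟩ := (mem_filter.1 hy).2
      obtain ⟨hmA, hmT⟩ := mem_filter.1 hm
      exact le_blockProb_output hP.1 hU0 (hPpos m hmA) hmT
    rw [Real.exp_neg, ← div_eq_mul_inv, div_le_iff₀ (Real.exp_pos _), one_mul] at h1
    exact h1
  rw [errorProb_eq C hM, one_div, ← div_eq_inv_mul, le_div_iff₀ (by positivity)]
  refine le_trans ?_ (sum_le_sum fun y _ => hy y)
  rw [sum_sub_distrib, ← sum_mul, ← sum_filter, sum_const, nsmul_eq_mul]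
  have h1 : (A.card : ℝ) * (1 / 2 * Real.exp (n * (H₁ - ε))) * α ≤
      (∑ y, ((S y).card : ℝ)) * α := mul_le_mul_of_nonneg_right hScard hα0
  have h2 : (G.card : ℝ) * β ≤ Real.exp (n * (H₂ + ε)) * β :=
    mul_le_mul_of_nonneg_right hGcard hβ0
  set E : ℝ := Real.exp (-(n * (B - H₁ + 2 * ε))) with hE
  have hE0 : 0 < E := Real.exp_pos _
  have h3 : M * L * E / (2 * N) ≤
      (A.card : ℝ) * (1 / 2 * Real.exp (n * (H₁ - ε))) * α := by
    have e : Real.exp (n * (H₁ - ε)) * Real.exp (-(n * (B + ε))) = E := by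
      rw [← Real.exp_add]
      congr 1
      ring
    calc M * L * E / (2 * N) ≤ (N * A.card) * L * E / (2 * N) := by gcongr
      _ = A.card * L * (1 / 2) * E := by field_simp
      _ = _ := by rw [hα, ← e]; ring
  -- The two summands of `β` use the two branches of `|B - K|⁺` in `hrate`: `e1` uses `B - K` and
  -- needs slack `4ε`, `e2` uses 0 and needs `5ε`. Both leave a spare factor `e^{-nε}`.
  have h4 : Real.exp (n * (H₂ + ε)) * β ≤
      M * L * ((4 * (n * R) + 4) * (E * Real.exp (-(n * ε)))) := by
    have k1 := le_max_left 0 (B - K)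
    have k2 := le_max_right 0 (B - K)
    have e1 : Real.exp (n * (H₂ + ε)) ≤
        E * Real.exp (-(n * ε)) * (Real.exp (n * R) * Real.exp (n * K)) := by
      rw [← Real.exp_add, ← Real.exp_add, ← Real.exp_add]
      refine Real.exp_le_exp.2 ?_
      nlinarith
    have e2 : Real.exp (n * (H₂ + ε)) * Real.exp (-(n * (B - ε))) ≤
        E * Real.exp (-(n * ε)) * Real.exp (n * R) := by
      rw [← Real.exp_add, ← Real.exp_add, ← Real.exp_add]
      refine Real.exp_le_exp.2 ?_
      nlinarith
    have e3 : Real.exp (n * R) * Real.exp (n * K) ≤ 4 * (M * L) := by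
      calc _ ≤ (2 * M) * (2 * (L : ℝ)) := by gcongr
        _ = _ := by ring
    have hE1 : 0 ≤ E * Real.exp (-(n * ε)) := by positivity
    calc Real.exp (n * (H₂ + ε)) * β
        = n * R * Real.exp (n * (H₂ + ε)) +
          2 * L * (Real.exp (n * (H₂ + ε)) * Real.exp (-(n * (B - ε)))) := by rw [hβ]; ring
      _ ≤ n * R * (E * Real.exp (-(n * ε)) * (4 * (M * L))) +
          2 * L * (E * Real.exp (-(n * ε)) * (2 * M)) := by
          have e4 := e1.trans (mul_le_mul_of_nonneg_left e3 hE1)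
          have e5 := e2.trans (mul_le_mul_of_nonneg_left hM2 hE1)
          gcongr
      _ = _ := by ring
  -- By `hnN` the spare factor beats the polynomial terms, so the subtracted maxima cost at most
  -- half of the main term in `h3`.
  have h5 : M * L * ((4 * (n * R) + 4) * (E * Real.exp (-(n * ε)))) ≤ M * L * E / (4 * N) := by
    rw [le_div_iff₀ (by positivity)]
    have := mul_le_mul_of_nonneg_left hnN (show 0 ≤ M * L * E by positivity)
    linarith
  have h6 : M * L * E / (2 * N) = M * L * E / (4 * N) + M * L * E / (4 * N) := by
    field_simp
    norm_num
  have h7 : E / (4 * N) * (M * L) = M * L * E / (4 * N) := by ring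
  linarith

end ErrorLowerBound

/-! ### Rounding of the sizes and absorption of polynomial factors. -/

section Asymptotics

theorem one_le_exp_mul (n : ℕ) {r : ℝ} (hr : 0 < r) : 1 ≤ Real.exp (n * r) :=
  Real.one_le_exp (by positivity)

theorem expSize_pos (n : ℕ) {r : ℝ} (hr : 0 < r) : 0 < expSize n r :=
  Nat.floor_pos.2 (one_le_exp_mul n hr)

theorem expSize_le (n : ℕ) (r : ℝ) : (expSize n r : ℝ) ≤ Real.exp (n * r) :=
  Nat.floor_le (Real.exp_pos _).le

theorem exp_le_two_mul_expSize (n : ℕ) {r : ℝ} (hr : 0 < r) :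
    Real.exp (n * r) ≤ 2 * expSize n r := by
  have h1 : (1 : ℝ) ≤ expSize n r := by exact_mod_cast expSize_pos n hr
  have h2 := Nat.lt_floor_add_one (Real.exp (n * r))
  unfold expSize at h1 ⊢
  linarith

theorem exponent_antitone (n : ℕ) : Antitone (exponent n) := by
  intro p q h
  unfold exponent
  refine EReal.neg_le_neg_iff.2 (mul_le_mul_of_nonneg_left
    (ENNReal.log_monotone (ENNReal.ofReal_le_ofReal h)) ?_)
  exact_mod_cast (by positivity : (0 : ℝ) ≤ 1 / n)

theorem exponent_exp {n : ℕ} (hn : 0 < n) (b : ℝ) : exponent n (Real.exp (-(n * b))) = b := by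
  unfold exponent
  have hn' : (n : ℝ) ≠ 0 := by positivity
  rw [ENNReal.log_ofReal_of_pos (Real.exp_pos _), Real.log_exp, ← EReal.coe_mul, ← EReal.coe_neg]
  congr 1
  field_simp

theorem eventually_pow_mul_exp_le (A : ℝ) (k : ℕ) {c : ℝ} (hc : 0 < c) :
    ∀ᶠ n : ℕ in atTop, A * ((n : ℝ) + 1) ^ k * Real.exp (-(n * c)) ≤ 1 := by
  have h1 : Tendsto (fun x : ℝ => x ^ k / Real.exp (c * x)) atTop (nhds 0) :=
    (isLittleO_pow_exp_pos_mul_atTop k hc).tendsto_div_nhds_zero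
  have h2 : Tendsto (fun n : ℕ => (n : ℝ) + 1) atTop atTop :=
    tendsto_atTop_add_const_right _ _ tendsto_natCast_atTop_atTop
  have h3 := ((h1.comp h2).const_mul (A * Real.exp c))
  rw [mul_zero] at h3
  filter_upwards [h3.eventually (ge_mem_nhds zero_lt_one)] with n hn
  refine le_trans (le_of_eq ?_) hn
  simp only [Function.comp]
  have : Real.exp (c * ((n : ℝ) + 1)) = Real.exp (n * c) * Real.exp c := by
    rw [← Real.exp_add]
    congr 1
    ring
  rw [this, Real.exp_neg]
  field_simp

end Asymptotics

/-! ### Constant-composition subcodes and the two asymptotic bounds. -/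

section Main

open Classical in
/-- Every codebook has a large subcode of constant composition. -/
theorem exists_constant_composition {X : Type*} [Fintype X] {n M : ℕ} (hn : 0 < n)
    (hM : 0 < M) (C : Codebook X n M) :
    ∃ A : Finset (Fin M), ∃ P ∈ stdSimplex ℝ X,
      (M : ℝ) ≤ ((n : ℝ) + 1) ^ Fintype.card X * A.card ∧
      (∀ m ∈ A, ∀ g : X → ℝ, ∑ i, g (C m i) = n * ∑ a, P a * g a) ∧
      ∀ m ∈ A, ∀ i, 0 < P (C m i) := by
  have hn' : (n : ℝ) ≠ 0 := by positivity
  -- Pigeonhole: take the most frequent of the at most `(n + 1)^|X|` types.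
  obtain ⟨t, ht⟩ := Finite.exists_max fun t : X → Fin (n + 1) =>
    (univ.filter fun m => letterCount (C m) = t).card
  have hcard : (M : ℝ) ≤ ((n : ℝ) + 1) ^ Fintype.card X *
      (univ.filter fun m => letterCount (C m) = t).card := by
    have h1 := card_eq_sum_card_fiberwise (s := (univ : Finset (Fin M)))
      (t := (univ : Finset (X → Fin (n + 1)))) (f := fun m => letterCount (C m))
      (fun _ _ => mem_univ _)
    have h2 := h1.le.trans (sum_le_card_nsmul _ _ _ fun s _ => ht s)
    simp only [card_univ, Fintype.card_fun, Fintype.card_fin, smul_eq_mul] at h2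
    exact_mod_cast h2
  have htype : ∀ m ∈ univ.filter (fun m => letterCount (C m) = t), ∀ g : X → ℝ,
      ∑ i, g (C m i) = n * ∑ a, ((t a : ℕ) : ℝ) / n * g a := by
    intro m hm g
    rw [sum_comp_eq_sum_letterCount, (mem_filter.1 hm).2, mul_sum]
    refine sum_congr rfl fun a _ => ?_
    field_simp
  refine ⟨_, fun a => ((t a : ℕ) : ℝ) / n, ⟨fun a => by positivity, ?_⟩, hcard, htype, ?_⟩
  -- That the counts `t` add up to `n` is read off from an actual codeword of this type.
  · have hne : (univ.filter fun m => letterCount (C m) = t).Nonempty := by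
      rw [← card_pos]
      by_contra h
      rw [Nat.eq_zero_of_not_pos h] at hcard
      have : (0 : ℝ) < M := by positivity
      simp at hcard
      omega
    obtain ⟨m, hm⟩ := hne
    have := htype m hm fun _ => 1
    simp only [sum_const, card_univ, Fintype.card_fin, nsmul_eq_mul, mul_one] at this
    exact (mul_left_cancel₀ hn' (by rw [mul_one]; exact this)).symm
  · intro m hm i
    have h1 := (letterCount_ne_zero (C m) (C m i)).2 ⟨i, rfl⟩
    rw [(mem_filter.1 hm).2] at h1
    positivity

variable {X Y : Type*} [Fintype X] [Fintype Y] [DecidableEq Y] {W : X → Y → ℝ}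

theorem correctExp_le_liminf (hW : ∀ x, W x ∈ stdSimplex ℝ Y) {R K : ℝ} (hR : 0 < R)
    (hK : 0 < K) :
    correctExp W R K ≤ liminf (fun n : ℕ => ⨅ C : Codebook X n (expSize n R),
      exponent n (1 - errorProb W C (expSize n K))) atTop := by
  refine le_of_forall_lt_imp_le_of_dense fun c hc => ?_
  -- Two reals `c < b < a` below the exponent: the gap `a - b` absorbs the polynomial factor.
  obtain ⟨b, hcb, hb⟩ := EReal.lt_iff_exists_real_btwn.1 hc
  obtain ⟨a, hba, ha⟩ := EReal.lt_iff_exists_real_btwn.1 hb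
  rw [EReal.coe_lt_coe_iff] at hba
  refine hcb.le.trans (le_liminf_of_le (by isBoundedDefault) ?_)
  filter_upwards [eventually_pow_mul_exp_le (4 * R + 8) (Fintype.card X * Fintype.card Y + 1)
    (sub_pos.2 hba), eventually_gt_atTop 0] with n hn hn0
  refine le_iInf fun C => ?_
  rw [← exponent_exp hn0 b]
  refine exponent_antitone n ((one_sub_errorProb_le hW hR hn0 (expSize_pos n hR)
    (expSize_pos n hK) (expSize_le n R) (exp_le_two_mul_expSize n hR)
    (exp_le_two_mul_expSize n hK) C ha.le).trans ?_)
  set k := Fintype.card X * Fintype.card Y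
  have e : Real.exp (-(n * a)) = Real.exp (-(n * (a - b))) * Real.exp (-(n * b)) := by
    rw [← Real.exp_add]
    congr 1
    ring
  have h1 : 4 * (n * R) + 8 ≤ (4 * R + 8) * ((n : ℝ) + 1) := by
    have : (0 : ℝ) ≤ n := Nat.cast_nonneg n
    nlinarith
  rw [e, ← mul_assoc]
  refine mul_le_of_le_one_left (Real.exp_pos _).le (le_trans ?_ hn)
  refine mul_le_mul_of_nonneg_right ?_ (Real.exp_pos _).le
  calc ((n : ℝ) + 1) ^ k * (4 * (n * R) + 8)
      ≤ ((n : ℝ) + 1) ^ k * ((4 * R + 8) * ((n : ℝ) + 1)) := by gcongr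
    _ = _ := by ring

theorem limsup_le_errorExp (hW : ∀ x, W x ∈ stdSimplex ℝ Y) {R K : ℝ} (hR : 0 < R)
    (hK : 0 < K) (hjump : ¬ IsJumpRate W R K) :
    limsup (fun n : ℕ => ⨆ C : Codebook X n (expSize n R),
      exponent n (errorProb W C (expSize n K))) atTop ≤ errorExp W R K := by
  refine le_of_forall_gt_imp_ge_of_dense fun c hc => ?_
  -- The exponent at `R` is finite by `hc`; since `R` is not the jump rate, it is also finite at
  -- some smaller rate.
  obtain ⟨R', hR', hfin⟩ : ∃ R' < R, errorExp W R' K ≠ ⊤ := by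
    by_contra! h
    exact hjump ⟨h, (hc.trans_le le_top).ne⟩
  obtain ⟨b, hb, hbc⟩ := EReal.lt_iff_exists_real_btwn.1 hc
  obtain ⟨a₁, ha₁, hab⟩ := EReal.lt_iff_exists_real_btwn.1 hb
  obtain ⟨a₂, ha₂, -⟩ := EReal.lt_iff_exists_real_btwn.1 (lt_top_iff_ne_top.2 hfin)
  rw [EReal.coe_lt_coe_iff] at hab
  set d := b - a₁ with hd
  have hd0 : 0 < d := sub_pos.2 hab
  -- Weight `t` on a channel feasible at `R'` gains rate slack `t (R - R')` and costs at most `d /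
  -- 2` in divergence.
  obtain ⟨t, ht0, ht1, htd⟩ : ∃ t : ℝ, 0 < t ∧ t < 1 ∧ t * (a₂ - a₁) ≤ d / 2 := by
    have hp : 0 < 2 * (|a₂ - a₁| + 1) := by positivity
    refine ⟨min (1 / 2) (d / (2 * (|a₂ - a₁| + 1))), by positivity,
      (min_le_left _ _).trans_lt (by norm_num), ?_⟩
    calc _ ≤ min (1 / 2) (d / (2 * (|a₂ - a₁| + 1))) * (|a₂ - a₁| + 1) :=
          mul_le_mul_of_nonneg_left ((le_abs_self _).trans (by linarith)) (by positivity)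
      _ ≤ d / (2 * (|a₂ - a₁| + 1)) * (|a₂ - a₁| + 1) :=
          mul_le_mul_of_nonneg_right (min_le_right _ _) (by positivity)
      _ = d / 2 := by field_simp
  -- The first entry fits `5ε` into the rate slack. The second makes `2ε ≤ d / 4`, so the exponent
  -- stays below `a₁ + d/2 + d/4 = b - d/4`, and the last `d / 4` absorbs `4 (n + 1)^|X|`.
  set ε := min (t * (R - R') / 5) (d / 8) with hε
  have hε0 : 0 < ε := lt_min (by have := sub_pos.2 hR'; positivity) (by positivity)
  have hε1 : 5 * ε ≤ t * (R - R') := by linarith [min_le_left (t * (R - R') / 5) (d / 8)]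
  have hε2 : 8 * ε ≤ d := by linarith [min_le_right (t * (R - R') / 5) (d / 8)]
  refine (limsup_le_of_le (by isBoundedDefault) ?_).trans hbc.le
  have hV : ∀ᶠ n : ℕ in atTop, 6 * momentBound W ≤ n * ε ^ 2 :=
    (tendsto_natCast_atTop_atTop.atTop_mul_const (by positivity)).eventually_ge_atTop _
  filter_upwards [eventually_pow_mul_exp_le (16 * (R + 1)) (Fintype.card X + 1) hε0,
    eventually_pow_mul_exp_le 4 (Fintype.card X) (show 0 < d / 4 by positivity), hV,
    eventually_gt_atTop 0] with n hn1 hn2 hn3 hn0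
  refine iSup_le fun C => ?_
  -- `P` and then `U` depend on `n` and on the codebook, but `t`, `ε` and the thresholds on `n` were
  -- fixed beforehand.
  obtain ⟨A, P, hP, hA, hPA, hPpos⟩ := exists_constant_composition hn0 (expSize_pos n hR) C
  obtain ⟨U, hU, hdom, hI, hD⟩ := exists_mix (fun x => (hW x).1) (sub_pos.2 ht1) ht0
    (sub_add_cancel 1 t) ha₁ ha₂ hP
  have hnn : (0 : ℝ) ≤ n := Nat.cast_nonneg n
  have key := le_errorProb hW hn0 (expSize_pos n hR) (expSize_pos n hK) (expSize_le n R)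
    (exp_le_two_mul_expSize n hR) (exp_le_two_mul_expSize n hK) C A (by positivity) hA hP hU hPA
    hPpos hdom hε0 (by linarith) hn3 (by
      refine le_trans (mul_le_mul_of_nonneg_right ?_ (Real.exp_pos _).le) hn1
      calc 16 * (n * R + 1) * ((n : ℝ) + 1) ^ Fintype.card X
          ≤ 16 * ((R + 1) * (n + 1)) * ((n : ℝ) + 1) ^ Fintype.card X := by
            gcongr
            nlinarith
        _ = _ := by ring)
  rw [← exponent_exp hn0 b]
  refine exponent_antitone n (le_trans ?_ key)
  rw [le_div_iff₀ (by positivity)]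
  have e : Real.exp (-(n * b)) = Real.exp (-(n * (b - d / 4))) * Real.exp (-(n * (d / 4))) := by
    rw [← Real.exp_add]
    congr 1
    ring
  calc Real.exp (-(n * b)) * (4 * ((n : ℝ) + 1) ^ Fintype.card X)
      = Real.exp (-(n * (b - d / 4))) *
        (4 * ((n : ℝ) + 1) ^ Fintype.card X * Real.exp (-(n * (d / 4)))) := by rw [e]; ring
    _ ≤ Real.exp (-(n * (b - d / 4))) := mul_le_of_le_one_right (Real.exp_pos _).le hn2
    _ ≤ _ := by
        refine Real.exp_le_exp.2 (neg_le_neg (mul_le_mul_of_nonneg_left ?_ hnn))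
        linarith

end Main

end CloudChannel

theorem theorem2 {X Y : Type*} [Fintype X] [Nonempty X] [Fintype Y] [DecidableEq Y]
    (W : X → Y → ℝ) (hW : ∀ x, W x ∈ stdSimplex ℝ Y) (K : ℝ) (hK : 0 < K) :
    (∀ R : ℝ, 0 < R →
      CloudChannel.correctExp W R K ≤
        Filter.liminf (fun n : ℕ =>
          ⨅ C : CloudChannel.Codebook X n (CloudChannel.expSize n R),
            CloudChannel.exponent n
              (1 - CloudChannel.errorProb W C (CloudChannel.expSize n K))) Filter.atTop) ∧
    Antitone (fun R : ℝ => CloudChannel.errorExp W R K) ∧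
    (∀ R : ℝ, 0 < R → ¬ CloudChannel.IsJumpRate W R K →
      Filter.limsup (fun n : ℕ =>
          ⨆ C : CloudChannel.Codebook X n (CloudChannel.expSize n R),
            CloudChannel.exponent n
              (CloudChannel.errorProb W C (CloudChannel.expSize n K))) Filter.atTop ≤
        CloudChannel.errorExp W R K) :=
  ⟨fun _ hR => CloudChannel.correctExp_le_liminf hW hR hK, CloudChannel.errorExp_antitone W K,
    fun _ hR hj => CloudChannel.limsup_le_errorExp hW hR hK hj⟩
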